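/- Let $A\in\mathbb R^{K\times d}$, let $\Gamma\in\mathbb R^{K\times K}$ and $C_0\in\mathbb R^{d\times d}$ be symmetric positive definite, let $y\in\mathbb R^K$, and let $R:\mathbb R^d\to(-\infty,\infty]$ be proper, convex, lower semicontinuous (i.e. closed) and bounded below, with convex subdifferential $\partial R$. For an ensemble $x=(x^{(1)},\dots,x^{(J)})\in(\mathbb R^d)^J$ write $$\bar x=\frac1J\sum_{j=1}^J x^{(j)},\qquad e^{(j)}=x^{(j)}-\bar x,\qquad C(x)=\frac1J\sum_{j=1}^J e^{(j)}(e^{(j)})^\top ,$$ and for a positive definite matrix $C$ write $\|v\|_C=\sqrt{v^\top C^{-1}v}$. Given an initial ensemble $x_0$ and $T>0$, a solution on $[0,T]$ of the SEKI flow started at $x_0$ is an absolutely continuous curve $t\mapsto x(t)=(x^{(j)}(t))_{j=1}^J$ on $[0,T]$ with $x(0)=x_0$ such that, with $C(t)=C(x(t))$, for almost every $t\in[0,T]$ $$\frac{d\bar x(t)}{dt}+C(t)A^\top\Gamma^{-1}(A\bar x(t)-y)+C(t)C_0^{-1}\bar x(t)\in -C(t)\,\partial R(\bar x(t)),$$ $$\frac{de^{(j)}(t)}{dt}=-C(t)\bigl(A^\top\Gamma^{-1}A+C_0^{-1}\bigr)e^{(j)}(t),\qquad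 j=1,\dots,J.$$ For $\tau>0$ let $\mathcal A_\tau=\frac1\tau\bigl(\mathrm{Id}-(\mathrm{Id}+\tau\,\partial R)^{-1}\bigr)$ be the Yosida approximation of $\partial R$; the $\tau$-regularized system is the system of ordinary differential equations consisting of $$\frac{d\bar x_\tau}{dt}=-C(x_\tau)A^\top\Gamma^{-1}(A\bar x_\tau-y)-C(x_\tau)C_0^{-1}\bar x_\tau-C(x_\tau)\mathcal A_\tau(\bar x_\tau)$$ and the same equations for the deviations, required at every $t\in[0,T]$. **Theorem.** Let $x_0=(x_0^{(j)})_{j=1}^J$ be an initial ensemble such that $C(x_0)$ is positive definite and $R(\bar x_0)<\infty$. Then for every $T>0$: 1. The SEKI flow started at $x_0$ has a solution $x\in C([0,T];\mathbb R^{dJ})$ on $[0,T]$ (absolutely continuous by definition), and it is unique. 2. For every $\tau>0$ the $\tau$-regularized system has a unique solution $x_\tau$ on $[0,T]$ with $x_\tau(0)=x_0$, and $x_\tau\to x$ uniformly on $[0,T]$ as $\tau\downarrow0$. 3. If $z$ is a solution on $[0,T]$ of the SEKI flow started at any ensemble $z_0$ of $J$ particles with $C(z_0)=C(x_0)$, then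 for all $t\in[0,T]$ the matrix $C(t)=C(x(t))$ is positive definite, $C(z(t))=C(t)$, and $$\|\bar x(t)-\bar z(t)\|_{C(t)}\le\|\bar x_0-\bar z_0\|_{C(x_0)} .$$ -/

import Mathlib

open Set Filter Topology MeasureTheory
open scoped Matrix InnerProductSpace

noncomputable section

namespace SEKI

/-- The standing assumption on the regularization functional `R : ℝᵈ → (-∞, ∞]`:
proper, convex, closed (equivalently, lower semicontinuous), and bounded below. -/
structure IsRegularizer {d : ℕ} (R : EuclideanSpace ℝ (Fin d) → EReal) : Prop where
  ne_bot : ∀ x, R x ≠ ⊥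
  exists_ne_top : ∃ x, R x ≠ ⊤
  /-- convexity of an extended-real-valued function: its epigraph is convex -/
  convex_epigraph : Convex ℝ {p : EuclideanSpace ℝ (Fin d) × ℝ | R p.1 ≤ (p.2 : EReal)}
  lsc : LowerSemicontinuous R
  bddBelow : ∃ m : ℝ, ∀ x, (m : EReal) ≤ R x

/-- The convex subdifferential `∂R(x)`. (It is empty where a proper `R` takes the value `∞`.) -/
def subdiff {d : ℕ} (R : EuclideanSpace ℝ (Fin d) → EReal) (x : EuclideanSpace ℝ (Fin d)) :
    Set (EuclideanSpace ℝ (Fin d)) :=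
  {ξ | ∀ z, R x + ((⟪ξ, z - x⟫_ℝ : ℝ) : EReal) ≤ R z}

/-- Application of a matrix to a Euclidean vector. -/
def act {m n : ℕ} (M : Matrix (Fin m) (Fin n) ℝ) (x : EuclideanSpace ℝ (Fin n)) :
    EuclideanSpace ℝ (Fin m) :=
  WithLp.toLp 2 (M *ᵥ WithLp.ofLp x)

/-- The ensemble mean `x̄ = (1/J) ∑ⱼ x⁽ʲ⁾`. -/
def mean {d J : ℕ} (x : Fin J → EuclideanSpace ℝ (Fin d)) : EuclideanSpace ℝ (Fin d) :=
  (1 / (J : ℝ)) • ∑ j, x j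

/-- The ensemble deviations `e⁽ʲ⁾ = x⁽ʲ⁾ - x̄`. -/
def dev {d J : ℕ} (x : Fin J → EuclideanSpace ℝ (Fin d)) (j : Fin J) :
    EuclideanSpace ℝ (Fin d) :=
  x j - mean x

/-- The empirical covariance `C(x) = (1/J) ∑ⱼ (x⁽ʲ⁾ - x̄)(x⁽ʲ⁾ - x̄)ᵀ`. -/
def cov {d J : ℕ} (x : Fin J → EuclideanSpace ℝ (Fin d)) : Matrix (Fin d) (Fin d) ℝ :=
  (1 / (J : ℝ)) • ∑ j, Matrix.vecMulVec (WithLp.ofLp (dev x j)) (WithLp.ofLp (dev x j))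

/-- The weighted norm `‖v‖_C = √(vᵀ C⁻¹ v)` for positive definite `C`. -/
def wnorm {d : ℕ} (C : Matrix (Fin d) (Fin d) ℝ) (v : EuclideanSpace ℝ (Fin d)) : ℝ :=
  √(WithLp.ofLp v ⬝ᵥ (C⁻¹ *ᵥ WithLp.ofLp v))

/-- The smooth part `C Aᵀ Γ⁻¹ (A x̄ - y) + C C₀⁻¹ x̄` of the mean dynamics, where `C` is the
empirical covariance of the ensemble `x` and `x̄` its mean. -/
def meanDrift {d K J : ℕ} (A : Matrix (Fin K) (Fin d) ℝ) (Γ : Matrix (Fin K) (Fin K) ℝ)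
    (C₀ : Matrix (Fin d) (Fin d) ℝ) (y : EuclideanSpace ℝ (Fin K))
    (x : Fin J → EuclideanSpace ℝ (Fin d)) : EuclideanSpace ℝ (Fin d) :=
  act (cov x * Aᵀ * Γ⁻¹) (act A (mean x) - y) + act (cov x * C₀⁻¹) (mean x)

/-- The right-hand side `- C (Aᵀ Γ⁻¹ A + C₀⁻¹) e⁽ʲ⁾` of the deviation equations. -/
def devField {d K J : ℕ} (A : Matrix (Fin K) (Fin d) ℝ) (Γ : Matrix (Fin K) (Fin K) ℝ)
    (C₀ : Matrix (Fin d) (Fin d) ℝ) (x : Fin J → EuclideanSpace ℝ (Fin d)) (j : Fin J) :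
    EuclideanSpace ℝ (Fin d) :=
  -act (cov x * (Aᵀ * Γ⁻¹ * A + C₀⁻¹)) (dev x j)

/-- `x` is a solution on `[0,T]` of the SEKI flow started at the ensemble `x₀`, in the usual
(Carathéodory) sense of differential inclusions: `x` is absolutely continuous on `[0,T]`, and for
almost every `t ∈ [0,T]` the mean satisfies
`d x̄/dt + C Aᵀ Γ⁻¹ (A x̄ - y) + C C₀⁻¹ x̄ ∈ - C ∂R(x̄)` and every deviation satisfies
`d e⁽ʲ⁾/dt = - C (Aᵀ Γ⁻¹ A + C₀⁻¹) e⁽ʲ⁾`. -/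
structure IsSolution {d K J : ℕ} (A : Matrix (Fin K) (Fin d) ℝ) (Γ : Matrix (Fin K) (Fin K) ℝ)
    (C₀ : Matrix (Fin d) (Fin d) ℝ) (y : EuclideanSpace ℝ (Fin K))
    (R : EuclideanSpace ℝ (Fin d) → EReal) (T : ℝ) (x₀ : Fin J → EuclideanSpace ℝ (Fin d))
    (x : ℝ → Fin J → EuclideanSpace ℝ (Fin d)) : Prop where
  init : x 0 = x₀
  absCont : AbsolutelyContinuousOnInterval x 0 T
  mean_inclusion : ∀ᵐ t ∂(volume.restrict (Icc (0 : ℝ) T)),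
    ∃ v, HasDerivAt (fun s => mean (x s)) v t ∧
      v + meanDrift A Γ C₀ y (x t) ∈ (fun ξ => -act (cov (x t)) ξ) '' subdiff R (mean (x t))
  dev_eq : ∀ᵐ t ∂(volume.restrict (Icc (0 : ℝ) T)),
    ∀ j, HasDerivAt (fun s => dev (x s) j) (devField A Γ C₀ (x t) j) t

/-- The resolvent `(Id + τ ∂R)⁻¹`, for `τ > 0`: the point `z` with `x ∈ z + τ ∂R(z)`, which exists
and is unique for a proper, closed, convex `R`. -/
def resolvent {d : ℕ} (R : EuclideanSpace ℝ (Fin d) → EReal) (τ : ℝ)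
    (x : EuclideanSpace ℝ (Fin d)) : EuclideanSpace ℝ (Fin d) :=
  Classical.epsilon fun z => ∃ ξ ∈ subdiff R z, z + τ • ξ = x

/-- The Yosida approximation `(Id - (Id + τ ∂R)⁻¹) / τ` of `∂R`. -/
def yosida {d : ℕ} (R : EuclideanSpace ℝ (Fin d) → EReal) (τ : ℝ)
    (x : EuclideanSpace ℝ (Fin d)) : EuclideanSpace ℝ (Fin d) :=
  τ⁻¹ • (x - resolvent R τ x)

/-- `x` is a (classical) solution on `[0,T]`, started at `x₀`, of the regularized system in which
`∂R` is replaced by its Yosida approximation of parameter `τ`. -/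
structure IsYosidaSolution {d K J : ℕ} (A : Matrix (Fin K) (Fin d) ℝ)
    (Γ : Matrix (Fin K) (Fin K) ℝ) (C₀ : Matrix (Fin d) (Fin d) ℝ) (y : EuclideanSpace ℝ (Fin K))
    (R : EuclideanSpace ℝ (Fin d) → EReal) (τ T : ℝ) (x₀ : Fin J → EuclideanSpace ℝ (Fin d))
    (x : ℝ → Fin J → EuclideanSpace ℝ (Fin d)) : Prop where
  init : x 0 = x₀
  mean_eq : ∀ t ∈ Icc (0 : ℝ) T, HasDerivWithinAt (fun s => mean (x s))
    (-meanDrift A Γ C₀ y (x t) - act (cov (x t)) (yosida R τ (mean (x t)))) (Icc 0 T) t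
  dev_eq : ∀ t ∈ Icc (0 : ℝ) T, ∀ j,
    HasDerivWithinAt (fun s => dev (x s) j) (devField A Γ C₀ (x t) j) (Icc 0 T) t

end SEKI

end

/-! Write `H = AᵀΓ⁻¹A + C₀⁻¹` and `b = AᵀΓ⁻¹y`. The deviation equations do not involve the mean, and
they force `C' = -2CHC`, so `C⁻¹` has the constant derivative `2H`. Hence `C(t)` is the inverse of
`Q(t) = C(x₀)⁻¹ + 2tH`, for every flow with the same initial covariance (`covOp_precision_of_ac`).
Conversely, a linear flow with this prescribed covariance produces the deviations
(`exists_deviations`). Everything nonlinear is then in the mean `m`, which after multiplication by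
`Q` satisfies `Q m' + H m + ξ = b` with `ξ ∈ ∂R(m)`.

For two such means `m`, `n` with subgradients `ξ`, `η`, the derivative of `⟪Q(m - n), m - n⟫` is
`-2⟪ξ - η, m - n⟫ ≤ 0`: the growth `2H` of the metric exactly cancels the linear term. This is the
contraction estimate (`IsCoercivePair.contraction`), and it gives uniqueness both for the flow and
for its regularizations.

For existence, the regularized mean is a gradient flow in the metric `Q`: the energy `moreau + ½⟪Hx,
x⟫ - ⟪b, x⟫` decreases at rate `⟪Qv, v⟫`, where `v = m'`. Finiteness of `R` at the initial mean
bounds the initial energy uniformly in `τ`, so the dissipation controls the velocities and the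
Yosida terms in `L²`. Approximate monotonicity of two Yosida approximations then gives a squared
distance of order `τ + σ` (`norm_yosidaMean_sub_sq_le`), hence a uniform limit, absolutely
continuous by the `L²` bound. The inclusion is recovered at each point of differentiability
(`limit_mem_subdiff`): against a fixed `z`, the subgradient inequality bounds the derivative of
`⟪Q(m_τ - z), m_τ - z⟫` on a neighbourhood independent of `τ`, so no convergence of the velocities
is needed. -/

/-! ### Absolutely continuous functions -/

namespace AbsolutelyContinuousOnInterval

theorem lipschitz_comp {X Y : Type*} [PseudoMetricSpace X] [PseudoMetricSpace Y] {f : ℝ → X}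
    {a b : ℝ} (hf : AbsolutelyContinuousOnInterval f a b) {K : NNReal} {g : X → Y}
    (hg : LipschitzWith K g) : AbsolutelyContinuousOnInterval (fun t => g (f t)) a b := by
  refine squeeze_zero (fun _ => Finset.sum_nonneg fun _ _ => dist_nonneg) (fun E => ?_)
    (by simpa using Tendsto.const_mul (K : ℝ) hf)
  rw [Finset.mul_sum]
  exact Finset.sum_le_sum fun i _ => hg.dist_le_mul _ _

theorem clm_apply {E F : Type*} [NormedAddCommGroup E] [NormedSpace ℝ E] [NormedAddCommGroup F]
    [NormedSpace ℝ F] {f : ℝ → E} {a b : ℝ} (hf : AbsolutelyContinuousOnInterval f a b)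
    (L : E →L[ℝ] F) : AbsolutelyContinuousOnInterval (fun t => L (f t)) a b :=
  hf.lipschitz_comp L.lipschitz

theorem inner {E : Type*} [NormedAddCommGroup E] [InnerProductSpace ℝ E] {f g : ℝ → E} {a b : ℝ}
    (hf : AbsolutelyContinuousOnInterval f a b) (hg : AbsolutelyContinuousOnInterval g a b) :
    AbsolutelyContinuousOnInterval (fun t => ⟪f t, g t⟫_ℝ) a b := by
  obtain ⟨C, hC⟩ := hf.exists_bound
  obtain ⟨D, hD⟩ := hg.exists_bound
  unfold AbsolutelyContinuousOnInterval at hf hg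
  apply squeeze_zero' (Eventually.of_forall fun _ => Finset.sum_nonneg fun _ _ => dist_nonneg) ?_
    (by simpa using (hg.const_mul C).add (hf.const_mul D))
  rw [eventually_inf_principal]
  filter_upwards with (n, I) hnI
  simp only [Finset.mul_sum, ← Finset.sum_add_distrib]
  refine Finset.sum_le_sum fun i hi => ?_
  have h1 := hC _ (hnI.1 i hi).1
  have h2 := hD _ (hnI.1 i hi).2
  have key : ⟪f (I i).1, g (I i).1⟫_ℝ - ⟪f (I i).2, g (I i).2⟫_ℝ =
      ⟪f (I i).1, g (I i).1 - g (I i).2⟫_ℝ + ⟪f (I i).1 - f (I i).2, g (I i).2⟫_ℝ := by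
    rw [inner_sub_right, inner_sub_left]; ring
  rw [Real.dist_eq, key, dist_eq_norm, dist_eq_norm]
  refine (abs_add_le _ _).trans (add_le_add ?_ ?_)
  · exact (abs_real_inner_le_norm _ _).trans (by gcongr)
  · exact (abs_real_inner_le_norm _ _).trans (by rw [mul_comm]; gcongr)

theorem finset_sum {ι E : Type*} [NormedAddCommGroup E] {a b : ℝ} (s : Finset ι) {f : ι → ℝ → E}
    (hf : ∀ i ∈ s, AbsolutelyContinuousOnInterval (f i) a b) :
    AbsolutelyContinuousOnInterval (fun t => ∑ i ∈ s, f i t) a b := by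
  classical
  induction s using Finset.induction_on with
  | empty =>
    simpa using (LipschitzWith.const (0 : E) : LipschitzWith 0 fun _ : ℝ =>
      (0 : E)).lipschitzOnWith.absolutelyContinuousOnInterval
  | insert i s hi ih =>
    simp only [Finset.sum_insert hi]
    exact (hf i (by simp)).fun_add (ih fun j hj => hf j (by simp [hj]))

theorem pi {ι : Type*} [Fintype ι] {E : Type*} [NormedAddCommGroup E] {a b : ℝ}
    {f : ℝ → ι → E} (hf : ∀ i, AbsolutelyContinuousOnInterval (fun t => f t i) a b) :
    AbsolutelyContinuousOnInterval f a b := by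
  have h := tendsto_finsetSum Finset.univ fun i _ => hf i
  refine squeeze_zero (fun _ => Finset.sum_nonneg fun _ _ => dist_nonneg) (fun E => ?_)
    (by simpa using h)
  rw [Finset.sum_comm]
  refine Finset.sum_le_sum fun k _ => ?_
  refine (dist_pi_le_iff (Finset.sum_nonneg fun _ _ => dist_nonneg)).2 fun i => ?_
  exact Finset.single_le_sum (f := fun i => dist (f (E.2 k).1 i) (f (E.2 k).2 i))
    (fun _ _ => dist_nonneg) (Finset.mem_univ i)

/-- An absolutely continuous function with almost everywhere nonpositive derivative does not
exceed its initial value. -/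
theorem le_of_ae_deriv_nonpos {f : ℝ → ℝ} {T : ℝ} (hf : AbsolutelyContinuousOnInterval f 0 T)
    (hd : ∀ᵐ t ∂(volume.restrict (Icc (0 : ℝ) T)), ∃ v ≤ 0, HasDerivAt f v t) {t : ℝ}
    (ht : t ∈ Icc 0 T) : f t ≤ f 0 := by
  have hT : (0 : ℝ) ≤ T := ht.1.trans ht.2
  have hf' : AbsolutelyContinuousOnInterval f 0 t :=
    hf.mono (by rw [uIcc_of_le ht.1, uIcc_of_le hT]; exact Icc_subset_Icc_right ht.2)
  have h := hf'.integral_deriv_eq_sub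
  have h2 : ∫ s in (0 : ℝ)..t, deriv f s ≤ 0 := by
    rw [intervalIntegral.integral_of_le ht.1]
    refine integral_nonpos_of_ae ?_
    have hsub : Ioc 0 t ⊆ Icc 0 T := fun s hs => ⟨hs.1.le, hs.2.trans ht.2⟩
    filter_upwards [ae_restrict_of_ae_restrict_of_subset hsub hd] with s hs
    obtain ⟨v, hv, hv'⟩ := hs
    rw [hv'.deriv]; exact hv
  linarith

/-- Grönwall's inequality, homogeneous case, for absolutely continuous curves. -/
theorem eq_zero_of_ae_norm_deriv_le {E : Type*} [NormedAddCommGroup E] [InnerProductSpace ℝ E]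
    {w : ℝ → E} {T L : ℝ} (hw : AbsolutelyContinuousOnInterval w 0 T)
    (hd : ∀ᵐ t ∂(volume.restrict (Icc (0 : ℝ) T)), ∃ v, HasDerivAt w v t ∧ ‖v‖ ≤ L * ‖w t‖)
    (h0 : w 0 = 0) {t : ℝ} (ht : t ∈ Icc 0 T) : w t = 0 := by
  -- The weight `exp(-2Lt)` makes `exp(-2Lt)‖w‖²` nonincreasing, since `(‖w‖²)' ≤ 2L‖w‖²`.
  have hexp : AbsolutelyContinuousOnInterval (fun t : ℝ => Real.exp (-(2 * L) * t)) 0 T :=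
    ContDiffOn.absolutelyContinuousOnInterval (by fun_prop)
  have hac := hexp.fun_mul (hw.inner hw)
  have := hac.le_of_ae_deriv_nonpos (t := t) (by
    filter_upwards [hd] with s hs
    obtain ⟨v, hv, hle⟩ := hs
    have he : HasDerivAt (fun t : ℝ => Real.exp (-(2 * L) * t))
        (Real.exp (-(2 * L) * s) * (-(2 * L))) s := by
      simpa using ((hasDerivAt_id s).const_mul (-(2 * L))).exp
    refine ⟨_, ?_, he.mul (hv.inner ℝ hv)⟩
    have h1 : ⟪w s, v⟫_ℝ ≤ ‖w s‖ * (L * ‖w s‖) :=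
      (real_inner_le_norm _ _).trans (by gcongr)
    have hpos := Real.exp_pos (-(2 * L) * s)
    have h2 : Real.exp (-(2 * L) * s) * (⟪w s, v⟫_ℝ - L * ‖w s‖ ^ 2) ≤ 0 :=
      mul_nonpos_of_nonneg_of_nonpos hpos.le (by nlinarith)
    rw [real_inner_comm (w s) v, real_inner_self_eq_norm_sq]
    nlinarith) ht
  simp only [h0, inner_zero_left, mul_zero, real_inner_self_eq_norm_sq] at this
  have hpos := Real.exp_pos (-(2 * L) * t)
  have h3 : ‖w t‖ ^ 2 ≤ 0 := by
    by_contra! hh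
    exact absurd this (not_le.2 (mul_pos hpos hh))
  exact norm_eq_zero.1 (pow_eq_zero_iff two_ne_zero |>.1 (le_antisymm h3 (sq_nonneg _)))

end AbsolutelyContinuousOnInterval

/-- A function differentiable on `[0,T]` with bounded derivative is absolutely continuous. -/
theorem absolutelyContinuousOnInterval_of_hasDerivWithinAt {E : Type*} [NormedAddCommGroup E]
    [NormedSpace ℝ E] {f f' : ℝ → E} {T : ℝ} (hT : 0 ≤ T)
    (hf : ∀ t ∈ Icc (0 : ℝ) T, HasDerivWithinAt f (f' t) (Icc 0 T) t) {L : ℝ}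
    (hL : ∀ t ∈ Icc (0 : ℝ) T, ‖f' t‖ ≤ L) : AbsolutelyContinuousOnInterval f 0 T := by
  have hL0 : 0 ≤ L := (norm_nonneg _).trans (hL 0 ⟨le_rfl, hT⟩)
  refine LipschitzOnWith.absolutelyContinuousOnInterval (K := ⟨L, hL0⟩) ?_
  rw [uIcc_of_le hT]
  exact (convex_Icc 0 T).lipschitzOnWith_of_nnnorm_hasDerivWithin_le hf fun t ht => hL t ht

/-- The endpoints are a null set; on the open interval derivatives within `Icc 0 T` are genuine
derivatives. -/
theorem ae_restrict_Icc_of_forall_Ioo {p : ℝ → Prop} {T : ℝ} (h : ∀ t ∈ Ioo 0 T, p t) :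
    ∀ᵐ t ∂(volume.restrict (Icc (0 : ℝ) T)), p t := by
  rw [Measure.restrict_congr_set Ioo_ae_eq_Icc.symm]
  exact (ae_restrict_iff' measurableSet_Ioo).2 (Eventually.of_forall h)

/-- A pointwise limit of `C¹` curves whose derivatives are bounded in `L²` is absolutely
continuous. -/
theorem absolutelyContinuousOnInterval_of_tendsto {E ι : Type*} [NormedAddCommGroup E]
    [NormedSpace ℝ E] [CompleteSpace E] {l : Filter ι} [l.NeBot] {f f' : ι → ℝ → E} {g : ℝ → E}
    {T M : ℝ} (hT : 0 ≤ T)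
    (hf : ∀ᶠ i in l, (∀ t ∈ Icc (0 : ℝ) T, HasDerivWithinAt (f i) (f' i t) (Icc 0 T) t) ∧
      ContinuousOn (f' i) (Icc 0 T) ∧ ∫ t in (0 : ℝ)..T, ‖f' i t‖ ^ 2 ≤ M)
    (hlim : ∀ t ∈ Icc (0 : ℝ) T, Tendsto (fun i => f i t) l (𝓝 (g t))) :
    AbsolutelyContinuousOnInterval g 0 T := by
  have hM : 0 ≤ M := by
    obtain ⟨i, hi⟩ := hf.exists
    exact (intervalIntegral.integral_nonneg hT fun _ _ => by positivity).trans hi.2.2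
  rw [absolutelyContinuousOnInterval_iff]
  intro ε hε
  -- Chosen so that `κ(M + 1) = ε/4`; with total length below `κε` the other Young term is also at
  -- most `ε/4`.
  set κ : ℝ := ε / (4 * (M + 1)) with hκ
  have hκpos : 0 < κ := by positivity
  refine ⟨κ * ε, by positivity, ?_⟩
  rintro ⟨n, I⟩ hI hlt
  simp only at hlt ⊢
  have hsubU : ∀ k ∈ Finset.range n, uIoc (I k).1 (I k).2 ⊆ Ioc 0 T := fun k hk => by
    have := AbsolutelyContinuousOnInterval.uIoc_subset_of_mem_disjWithin hI (Finset.mem_range.1 hk)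
    rwa [uIoc_of_le hT] at this
  have hmem : ∀ k ∈ Finset.range n, (I k).1 ∈ Icc 0 T ∧ (I k).2 ∈ Icc 0 T := fun k hk => by
    have := hI.1 k hk
    rwa [uIcc_of_le hT] at this
  suffices h : ∀ᶠ i in l, ∑ k ∈ Finset.range n, dist (f i (I k).1) (f i (I k).2) ≤ ε / 2 by
    have hl : Tendsto (fun i => ∑ k ∈ Finset.range n, dist (f i (I k).1) (f i (I k).2)) l
        (𝓝 (∑ k ∈ Finset.range n, dist (g (I k).1) (g (I k).2))) :=
      tendsto_finsetSum _ fun k hk => (hlim _ (hmem k hk).1).dist (hlim _ (hmem k hk).2)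
    linarith [le_of_tendsto hl h]
  filter_upwards [hf] with i hi
  obtain ⟨hd, hc, hint⟩ := hi
  have hsq : IntegrableOn (fun t => ‖f' i t‖ ^ 2) (Ioc 0 T) :=
    ((hc.norm.pow 2).integrableOn_Icc).mono_set Ioc_subset_Icc_self
  -- Young's inequality `‖v‖ ≤ κ‖v‖² + 1/(4κ)`, integrated over each interval, plays the role of
  -- Cauchy–Schwarz.
  have hterm : ∀ k ∈ Finset.range n, dist (f i (I k).1) (f i (I k).2) ≤
      κ * (∫ t in uIoc (I k).1 (I k).2, ‖f' i t‖ ^ 2) + (1 / (4 * κ)) * dist (I k).1 (I k).2 := by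
    intro k hk
    have hsub : uIcc (I k).1 (I k).2 ⊆ Icc 0 T := uIcc_subset_Icc (hmem k hk).1 (hmem k hk).2
    have hii : IntervalIntegrable (f' i) volume (I k).1 (I k).2 :=
      (hc.mono hsub).intervalIntegrable
    have hftc : ∫ t in (I k).1..(I k).2, f' i t = f i (I k).2 - f i (I k).1 := by
      refine intervalIntegral.integral_eq_sub_of_hasDeriv_right ?_ ?_ hii
      · exact fun t ht => ((hd t (hsub ht)).continuousWithinAt).mono hsub
      · intro t ht
        have hmin : 0 ≤ min (I k).1 (I k).2 := le_min (hmem k hk).1.1 (hmem k hk).2.1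
        have hmax : max (I k).1 (I k).2 ≤ T := max_le (hmem k hk).1.2 (hmem k hk).2.2
        have hnhds : Icc 0 T ∈ 𝓝 t := Icc_mem_nhds (hmin.trans_lt ht.1) (ht.2.trans_le hmax)
        exact ((hd t (mem_of_mem_nhds hnhds)).hasDerivAt hnhds).hasDerivWithinAt
    rw [dist_comm, dist_eq_norm, ← hftc]
    refine (intervalIntegral.norm_integral_le_integral_norm_uIoc).trans ?_
    have hk2 := hsq.mono_set (hsubU k hk)
    have hconst : IntegrableOn (fun _ : ℝ => 1 / (4 * κ)) (uIoc (I k).1 (I k).2) :=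
      integrableOn_const (by simp [uIoc])
    calc ∫ t in uIoc (I k).1 (I k).2, ‖f' i t‖
        ≤ ∫ t in uIoc (I k).1 (I k).2, (κ * ‖f' i t‖ ^ 2 + 1 / (4 * κ)) := by
          refine integral_mono (hii.norm.def') ((hk2.const_mul κ).add hconst) fun t => ?_
          have : 0 ≤ κ * (‖f' i t‖ - 1 / (2 * κ)) ^ 2 := by positivity
          have h2 : κ * (‖f' i t‖ - 1 / (2 * κ)) ^ 2 =
              κ * ‖f' i t‖ ^ 2 + 1 / (4 * κ) - ‖f' i t‖ := by field_simp; ring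
          simp only
          linarith
      _ = _ := by
          rw [integral_add (hk2.const_mul κ) hconst, integral_const_mul, setIntegral_const]
          congr 1
          rw [measureReal_def, uIoc, Real.volume_Ioc, max_sub_min_eq_abs', Real.dist_eq,
            ENNReal.toReal_ofReal (abs_nonneg _), smul_eq_mul, mul_comm]
  have hsum : ∑ k ∈ Finset.range n, ∫ t in uIoc (I k).1 (I k).2, ‖f' i t‖ ^ 2 ≤ M := by
    rw [← integral_biUnion_finset _ (by simp +contextual [uIoc]) hI.2
      fun k hk => hsq.mono_set (hsubU k hk)]
    rw [intervalIntegral.integral_of_le hT] at hint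
    refine le_trans (setIntegral_mono_set hsq (Eventually.of_forall fun t => by positivity) ?_) hint
    exact (iUnion₂_subset hsubU).eventuallyLE
  calc ∑ k ∈ Finset.range n, dist (f i (I k).1) (f i (I k).2)
      ≤ κ * (∑ k ∈ Finset.range n, ∫ t in uIoc (I k).1 (I k).2, ‖f' i t‖ ^ 2) +
        (1 / (4 * κ)) * ∑ k ∈ Finset.range n, dist (I k).1 (I k).2 := by
        rw [Finset.mul_sum, Finset.mul_sum, ← Finset.sum_add_distrib]
        exact Finset.sum_le_sum hterm
    _ ≤ κ * (M + 1) + (1 / (4 * κ)) * (κ * ε) := by gcongr; linarith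
    _ = ε / 2 := by rw [hκ]; field_simp; norm_num

/-- An absolutely continuous curve in a finite-dimensional space is differentiable almost
everywhere. -/
theorem AbsolutelyContinuousOnInterval.ae_restrict_differentiableAt {E : Type*}
    [NormedAddCommGroup E] [NormedSpace ℝ E] [FiniteDimensional ℝ E] {f : ℝ → E} {T : ℝ}
    (hf : AbsolutelyContinuousOnInterval f 0 T) (hT : 0 ≤ T) :
    ∀ᵐ t ∂(volume.restrict (Icc (0 : ℝ) T)), DifferentiableAt ℝ f t := by
  rw [ae_restrict_iff' measurableSet_Icc]
  have h := hf.boundedVariationOn.ae_differentiableAt_of_mem_uIcc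
  rwa [uIcc_of_le hT] at h

/-! ### Global solutions of globally Lipschitz differential equations -/

/-- The radial retraction of a normed space onto the ball of radius `ρ`. -/
noncomputable def radialRetraction {E : Type*} [NormedAddCommGroup E] [NormedSpace ℝ E] (ρ : ℝ)
    (x : E) : E :=
  (ρ / max ρ ‖x‖) • x

section radialRetraction

variable {E : Type*} [NormedAddCommGroup E] [NormedSpace ℝ E] {ρ : ℝ}

theorem norm_radialRetraction_le (hρ : 0 < ρ) (x : E) : ‖radialRetraction ρ x‖ ≤ ‖x‖ := by
  rw [radialRetraction, norm_smul, Real.norm_of_nonneg (by positivity)]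
  refine mul_le_of_le_one_left (norm_nonneg _) ?_
  exact div_le_one_of_le₀ (le_max_left _ _) (by positivity)

theorem radialRetraction_of_norm_le (hρ : 0 < ρ) {x : E} (hx : ‖x‖ ≤ ρ) :
    radialRetraction ρ x = x := by
  rw [radialRetraction, max_eq_left hx, div_self hρ.ne', one_smul]

theorem norm_radialRetraction_le_radius (hρ : 0 < ρ) (x : E) : ‖radialRetraction ρ x‖ ≤ ρ := by
  have hm : 0 < max ρ ‖x‖ := lt_max_of_lt_left hρ
  rw [radialRetraction, norm_smul, Real.norm_of_nonneg (by positivity), div_mul_eq_mul_div,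
    div_le_iff₀ hm]
  gcongr
  exact le_max_right _ _

/-- The increment splits into a rescaled `x - y` and a change of scale factor applied to `y`. Each
is at most `‖x - y‖` in any normed space, whence the constant `2`. -/
theorem lipschitzWith_radialRetraction (hρ : 0 < ρ) :
    LipschitzWith 2 (radialRetraction ρ : E → E) := by
  refine LipschitzWith.of_dist_le_mul fun x y => ?_
  have hx : 0 < max ρ ‖x‖ := lt_max_of_lt_left hρ
  have hy : 0 < max ρ ‖y‖ := lt_max_of_lt_left hρ
  have key : radialRetraction ρ x - radialRetraction ρ y =
      (ρ / max ρ ‖x‖) • (x - y) + (ρ / max ρ ‖x‖ - ρ / max ρ ‖y‖) • y := by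
    simp only [radialRetraction, smul_sub, sub_smul]; abel
  have h1 : ρ / max ρ ‖x‖ ≤ 1 := div_le_one_of_le₀ (le_max_left _ _) hx.le
  have hmax : |max ρ ‖y‖ - max ρ ‖x‖| ≤ ‖x - y‖ := by
    refine (abs_max_sub_max_le_max _ _ _ _).trans ?_
    rw [sub_self, abs_zero, norm_sub_rev]
    exact max_le (norm_nonneg _) (abs_norm_sub_norm_le _ _)
  have h2 : |ρ / max ρ ‖x‖ - ρ / max ρ ‖y‖| * ‖y‖ ≤ ‖x - y‖ := by
    have : ρ / max ρ ‖x‖ - ρ / max ρ ‖y‖ =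
        (ρ / max ρ ‖x‖) * ((max ρ ‖y‖ - max ρ ‖x‖) / max ρ ‖y‖) := by field_simp
    rw [this, abs_mul, abs_div (_ - _), abs_of_pos hy,
      abs_of_nonneg (by positivity : 0 ≤ ρ / max ρ ‖x‖)]
    calc ρ / max ρ ‖x‖ * (|max ρ ‖y‖ - max ρ ‖x‖| / max ρ ‖y‖) * ‖y‖
        = ρ / max ρ ‖x‖ * (|max ρ ‖y‖ - max ρ ‖x‖|) * (‖y‖ / max ρ ‖y‖) := by ring
      _ ≤ 1 * ‖x - y‖ * 1 := by
          gcongr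
          exact div_le_one_of_le₀ (le_max_right _ _) hy.le
      _ = _ := by ring
  rw [dist_eq_norm, dist_eq_norm, key]
  refine (norm_add_le _ _).trans ?_
  rw [norm_smul, norm_smul, Real.norm_eq_abs, Real.norm_eq_abs,
    abs_of_nonneg (by positivity : 0 ≤ ρ / max ρ ‖x‖), NNReal.coe_ofNat]
  nlinarith [norm_nonneg (x - y)]

end radialRetraction

/-- A vector field which is globally Lipschitz in space and continuous in time has solutions
on any compact time interval. -/
theorem exists_hasDerivWithinAt_of_lipschitz {E : Type*} [NormedAddCommGroup E] [NormedSpace ℝ E]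
    [CompleteSpace E] {f : ℝ → E → E} {T : ℝ} (hT : 0 ≤ T) {K : NNReal}
    (hK : ∀ t ∈ Icc (0 : ℝ) T, LipschitzWith K (f t))
    (hc : ∀ x, ContinuousOn (fun t => f t x) (Icc 0 T)) (x₀ : E) :
    ∃ x : ℝ → E, x 0 = x₀ ∧
      ∀ t ∈ Icc (0 : ℝ) T, HasDerivWithinAt x (f t (x t)) (Icc 0 T) t := by
  obtain ⟨F, hF⟩ := isCompact_Icc.exists_bound_of_continuousOn (hc 0)
  have hF0 : 0 ≤ F := (norm_nonneg _).trans (hF 0 ⟨le_rfl, hT⟩)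
  -- The field truncated at radius `ρ` is bounded, so Picard–Lindelöf covers `[0,T]` in one step.
  -- Grönwall keeps the solution below `ρ`, where the truncation does nothing; the `+ 1` makes `ρ`
  -- positive.
  set ρ : ℝ := gronwallBound ‖x₀‖ K F T + 1 with hρ
  have hmono := gronwallBound_mono (norm_nonneg x₀) hF0 K.coe_nonneg
  have hρpos : 0 < ρ := by
    have : ‖x₀‖ ≤ gronwallBound ‖x₀‖ K F T := by
      simpa [gronwallBound_x0] using hmono hT
    linarith [norm_nonneg x₀]
  have hbound : ∀ t ∈ Icc (0 : ℝ) T, ∀ z, ‖f t z‖ ≤ K * ‖z‖ + F := fun t ht z => by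
    have h1 := (hK t ht).dist_le_mul z 0
    rw [dist_eq_norm, dist_zero_right] at h1
    have h2 := norm_le_norm_add_norm_sub (f t 0) (f t z)
    rw [norm_sub_rev] at h2
    linarith [hF t ht]
  have hL0 : 0 ≤ K * ρ + F := by positivity
  set L : NNReal := ⟨K * ρ + F, hL0⟩
  have hPL : IsPicardLindelof (fun t z => f t (radialRetraction ρ z)) (tmin := 0) (tmax := T)
      ⟨0, le_rfl, hT⟩ x₀ (L * ⟨T, hT⟩) 0 L (K * 2) :=
    { lipschitzOnWith := fun t ht =>
        ((hK t ht).comp (lipschitzWith_radialRetraction hρpos)).lipschitzOnWith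
      continuousOn := fun z _ => hc _
      norm_le := fun t ht z _ => (hbound t ht _).trans (by
        have := norm_radialRetraction_le_radius hρpos z
        change _ ≤ K * ρ + F
        gcongr)
      mul_max_le := by
        simp only [sub_zero, sub_self, max_eq_left hT, NNReal.coe_zero]
        exact le_rfl }
  obtain ⟨x, hx0, hx⟩ := hPL.exists_eq_forall_mem_Icc_hasDerivWithinAt₀
  refine ⟨x, hx0, fun t ht => ?_⟩
  have hb := norm_le_gronwallBound_of_norm_deriv_right_le (f := x) (a := 0) (b := T)
    (δ := ‖x₀‖) (K := K) (ε := F)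
    (fun s hs => (hx s hs).continuousWithinAt)
    (fun s hs => ((hx s (Ico_subset_Icc_self hs)).mono_of_mem_nhdsWithin
      (Icc_mem_nhdsGE_of_mem hs))) (by rw [← hx0])
    (fun s hs => (hbound s (Ico_subset_Icc_self hs) _).trans (by
      gcongr
      exact norm_radialRetraction_le hρpos _)) t ht
  have hle : ‖x t‖ ≤ ρ := by
    have := hmono ht.2
    rw [sub_zero] at hb
    linarith
  have := hx t ht
  simp only [radialRetraction_of_norm_le hρpos hle] at this
  exact this

/-! ### Subdifferentials, resolvents and Yosida approximations -/

namespace SEKI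

section Convex

variable {d : ℕ} {R : EuclideanSpace ℝ (Fin d) → EReal}

namespace IsRegularizer

variable (hR : IsRegularizer R)
include hR

theorem coe_toReal {x : EuclideanSpace ℝ (Fin d)} (hx : R x ≠ ⊤) : ((R x).toReal : EReal) = R x :=
  EReal.coe_toReal hx (hR.ne_bot x)

theorem ne_top_of_mem_subdiff {x ξ : EuclideanSpace ℝ (Fin d)} (hξ : ξ ∈ subdiff R x) :
    R x ≠ ⊤ := by
  intro htop
  obtain ⟨z, hz⟩ := hR.exists_ne_top
  have := hξ z
  rw [htop, EReal.top_add_coe, top_le_iff] at this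
  exact hz this

theorem toReal_add_inner_le {x ξ z : EuclideanSpace ℝ (Fin d)} (hξ : ξ ∈ subdiff R x)
    (hz : R z ≠ ⊤) : (R x).toReal + ⟪ξ, z - x⟫_ℝ ≤ (R z).toReal := by
  have h := hξ z
  rw [← hR.coe_toReal (hR.ne_top_of_mem_subdiff hξ), ← hR.coe_toReal hz] at h
  exact_mod_cast h

theorem mem_subdiff {x ξ : EuclideanSpace ℝ (Fin d)} (hx : R x ≠ ⊤)
    (h : ∀ z, R z ≠ ⊤ → (R x).toReal + ⟪ξ, z - x⟫_ℝ ≤ (R z).toReal) : ξ ∈ subdiff R x := by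
  intro z
  by_cases hz : R z = ⊤
  · rw [hz]; exact le_top
  · rw [← hR.coe_toReal hx, ← hR.coe_toReal hz]
    exact_mod_cast h z hz

theorem inner_subdiff_nonneg {x y ξ η : EuclideanSpace ℝ (Fin d)} (hξ : ξ ∈ subdiff R x)
    (hη : η ∈ subdiff R y) : 0 ≤ ⟪ξ - η, x - y⟫_ℝ := by
  have h1 := hR.toReal_add_inner_le hξ (hR.ne_top_of_mem_subdiff hη)
  have h2 := hR.toReal_add_inner_le hη (hR.ne_top_of_mem_subdiff hξ)
  rw [inner_sub_left]
  rw [← neg_sub x y, inner_neg_right] at h1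
  linarith

theorem toReal_segment_le {x y : EuclideanSpace ℝ (Fin d)} (hx : R x ≠ ⊤) (hy : R y ≠ ⊤)
    {s : ℝ} (hs : 0 ≤ s) (hs1 : s ≤ 1) :
    R (x + s • (y - x)) ≤ (((1 - s) * (R x).toReal + s * (R y).toReal : ℝ) : EReal) := by
  have h := hR.convex_epigraph (x := (x, (R x).toReal)) (y := (y, (R y).toReal))
    (by simp [hR.coe_toReal hx]) (by simp [hR.coe_toReal hy]) (sub_nonneg.2 hs1) hs
    (sub_add_cancel 1 s)
  have e : x + s • (y - x) = (1 - s) • x + s • y := by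
    rw [smul_sub, sub_smul, one_smul]; abel
  rw [e]
  simpa using h

theorem exists_toReal_ge : ∃ m : ℝ, ∀ x, R x ≠ ⊤ → m ≤ (R x).toReal := by
  obtain ⟨m, hm⟩ := hR.bddBelow
  refine ⟨m, fun x hx => ?_⟩
  have := hm x
  rw [← hR.coe_toReal hx] at this
  exact_mod_cast this

/-- Existence of the proximal point: a minimizer of `R + ‖· - x‖² / (2τ)`. -/
theorem exists_isMin_prox {τ : ℝ} (hτ : 0 < τ) (x : EuclideanSpace ℝ (Fin d)) :
    ∃ z, R z ≠ ⊤ ∧ ∀ w, R w ≠ ⊤ →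
      (R z).toReal + ‖z - x‖ ^ 2 / (2 * τ) ≤ (R w).toReal + ‖w - x‖ ^ 2 / (2 * τ) := by
  obtain ⟨z₀, hz₀⟩ := hR.exists_ne_top
  obtain ⟨m, hm⟩ := hR.exists_toReal_ge
  -- Outside this ball the quadratic term, together with the lower bound `m` for `R`, already
  -- exceeds the value at `z₀`; a minimizer on the compact ball is therefore global.
  set r : ℝ := √(2 * τ * ((R z₀).toReal - m) + ‖z₀ - x‖ ^ 2) with hr
  have hin : 0 ≤ 2 * τ * ((R z₀).toReal - m) + ‖z₀ - x‖ ^ 2 := by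
    have := mul_nonneg (mul_nonneg zero_le_two hτ.le) (sub_nonneg.2 (hm z₀ hz₀))
    positivity
  have hr2 : r ^ 2 = 2 * τ * ((R z₀).toReal - m) + ‖z₀ - x‖ ^ 2 := Real.sq_sqrt hin
  have hmem : z₀ ∈ Metric.closedBall x r := by
    rw [mem_closedBall_iff_norm]
    refine abs_le_of_sq_le_sq' ?_ (Real.sqrt_nonneg _) |>.2
    rw [hr2]
    have := mul_nonneg (mul_nonneg zero_le_two hτ.le) (sub_nonneg.2 (hm z₀ hz₀))
    linarith
  have hlsc : LowerSemicontinuous fun z => R z + ((‖z - x‖ ^ 2 / (2 * τ) : ℝ) : EReal) := by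
    have hc : Continuous fun z : EuclideanSpace ℝ (Fin d) =>
        ((‖z - x‖ ^ 2 / (2 * τ) : ℝ) : EReal) :=
      continuous_coe_real_ereal.comp (by fun_prop)
    refine hR.lsc.add' hc.lowerSemicontinuous fun z => ?_
    exact EReal.continuousAt_add (Or.inr (EReal.coe_ne_bot _)) (Or.inr (EReal.coe_ne_top _))
  obtain ⟨z, hz, hmin⟩ := LowerSemicontinuousOn.exists_isMinOn ⟨z₀, hmem⟩
    (isCompact_closedBall x r) (hlsc.lowerSemicontinuousOn _)
  have hreal : ∀ w ∈ Metric.closedBall x r, R w ≠ ⊤ → R z ≠ ⊤ ∧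
      (R z).toReal + ‖z - x‖ ^ 2 / (2 * τ) ≤ (R w).toReal + ‖w - x‖ ^ 2 / (2 * τ) := by
    intro w hw hwt
    have h : R z + ((‖z - x‖ ^ 2 / (2 * τ) : ℝ) : EReal) ≤
      R w + ((‖w - x‖ ^ 2 / (2 * τ) : ℝ) : EReal) := hmin hw
    have hzt : R z ≠ ⊤ := by
      intro htop
      rw [htop, EReal.top_add_coe, ← hR.coe_toReal hwt, ← EReal.coe_add, top_le_iff] at h
      exact EReal.coe_ne_top _ h
    refine ⟨hzt, ?_⟩
    rw [← hR.coe_toReal hzt, ← hR.coe_toReal hwt] at h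
    exact_mod_cast h
  refine ⟨z, (hreal z₀ hmem hz₀).1, fun w hw => ?_⟩
  by_cases hwb : w ∈ Metric.closedBall x r
  · exact (hreal w hwb hw).2
  · refine (hreal z₀ hmem hz₀).2.trans ?_
    rw [mem_closedBall_iff_norm, not_le] at hwb
    have h1 : r ^ 2 ≤ ‖w - x‖ ^ 2 := by
      have := Real.sqrt_nonneg (2 * τ * ((R z₀).toReal - m) + ‖z₀ - x‖ ^ 2)
      gcongr
    rw [hr2] at h1
    have h2 := hm w hw
    have h3 : ‖z₀ - x‖ ^ 2 / (2 * τ) ≤ ‖w - x‖ ^ 2 / (2 * τ) - ((R z₀).toReal - m) := by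
      rw [le_sub_iff_add_le, div_add' _ _ _ (by positivity)]
      gcongr
      linarith
    linarith

/-- The resolvent equation `x ∈ z + τ ∂R(z)` is solvable. -/
theorem exists_resolvent {τ : ℝ} (hτ : 0 < τ) (x : EuclideanSpace ℝ (Fin d)) :
    ∃ z, ∃ ξ ∈ subdiff R z, z + τ • ξ = x := by
  obtain ⟨z, hz, hmin⟩ := hR.exists_isMin_prox hτ x
  refine ⟨z, τ⁻¹ • (x - z), hR.mem_subdiff hz fun w hw => ?_, by
    rw [smul_inv_smul₀ hτ.ne']; abel⟩
  set a : ℝ := (R w).toReal - (R z).toReal - ⟪τ⁻¹ • (x - z), w - z⟫_ℝ with ha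
  suffices h : 0 ≤ a by linarith
  set c : ℝ := ‖w - z‖ ^ 2 / (2 * τ) with hc
  -- Minimality is tested on the segment from `z` to `w`: convexity bounds `R`, the square is
  -- expanded, and the result is divided by `s`. Letting `s ↓ 0` removes the quadratic remainder.
  have hs : ∀ s ∈ Ioo (0 : ℝ) 1, 0 ≤ a + s * c := by
    intro s hs
    have hseg := hR.toReal_segment_le hz hw hs.1.le hs.2.le
    have hst : R (z + s • (w - z)) ≠ ⊤ := fun h => by
      rw [h, top_le_iff] at hseg; exact EReal.coe_ne_top _ hseg
    rw [← hR.coe_toReal hst, EReal.coe_le_coe_iff] at hseg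
    have h := hmin _ hst
    have e : ‖z + s • (w - z) - x‖ ^ 2 =
        ‖z - x‖ ^ 2 - 2 * s * ⟪x - z, w - z⟫_ℝ + s ^ 2 * ‖w - z‖ ^ 2 := by
      have : z + s • (w - z) - x = (z - x) + s • (w - z) := by abel
      rw [this, norm_add_sq_real, inner_smul_right, norm_smul, mul_pow, Real.norm_eq_abs, sq_abs,
        ← neg_sub x z, inner_neg_left, norm_neg]
      ring
    rw [e] at h
    have h4 : (‖z - x‖ ^ 2 - 2 * s * ⟪x - z, w - z⟫_ℝ + s ^ 2 * ‖w - z‖ ^ 2) / (2 * τ) =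
        ‖z - x‖ ^ 2 / (2 * τ) - s * (τ⁻¹ * ⟪x - z, w - z⟫_ℝ) + s * (s * c) := by
      rw [hc]; field_simp
    rw [h4] at h
    rw [ha, real_inner_smul_left]
    have h5 : 0 ≤ s * ((R w).toReal - (R z).toReal - τ⁻¹ * ⟪x - z, w - z⟫_ℝ + s * c) := by
      nlinarith
    exact nonneg_of_mul_nonneg_right h5 hs.1
  have hlim : Tendsto (fun s : ℝ => a + s * c) (𝓝[>] 0) (𝓝 (a + 0 * c)) :=
    (Continuous.tendsto (by fun_prop) 0).mono_left nhdsWithin_le_nhds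
  rw [zero_mul, add_zero] at hlim
  refine ge_of_tendsto hlim ?_
  filter_upwards [Ioo_mem_nhdsGT (zero_lt_one (α := ℝ))] with s h using hs s h

/-- Solvability makes the `epsilon` choice in `resolvent` a true solution, and the resolvent
equation identifies its subgradient with the Yosida quotient. Uniqueness of the resolvent is not
needed. -/
theorem yosida_mem_subdiff {τ : ℝ} (hτ : 0 < τ) (x : EuclideanSpace ℝ (Fin d)) :
    yosida R τ x ∈ subdiff R (resolvent R τ x) := by
  obtain ⟨ξ, hξ, h⟩ := Classical.epsilon_spec (hR.exists_resolvent hτ x)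
  change ξ ∈ subdiff R (resolvent R τ x) at hξ
  change resolvent R τ x + τ • ξ = x at h
  have : yosida R τ x = ξ := by
    rw [yosida, ← eq_sub_iff_add_eq'.2 h, inv_smul_smul₀ hτ.ne']
  rwa [this]

end IsRegularizer

theorem resolvent_eq {τ : ℝ} (hτ : 0 < τ) (x : EuclideanSpace ℝ (Fin d)) :
    resolvent R τ x = x - τ • yosida R τ x := by
  rw [yosida, smul_inv_smul₀ hτ.ne']; abel

namespace IsRegularizer

variable (hR : IsRegularizer R)
include hR

/-- Cocoercivity: this is monotonicity of the subdifferential at the resolvent points, rewritten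
through `resolvent = x - τ • yosida`. -/
theorem mul_norm_yosida_sub_sq_le {τ : ℝ} (hτ : 0 < τ) (x y : EuclideanSpace ℝ (Fin d)) :
    τ * ‖yosida R τ x - yosida R τ y‖ ^ 2 ≤ ⟪yosida R τ x - yosida R τ y, x - y⟫_ℝ := by
  have h := hR.inner_subdiff_nonneg (hR.yosida_mem_subdiff hτ x) (hR.yosida_mem_subdiff hτ y)
  have e : resolvent R τ x - resolvent R τ y =
      (x - y) - τ • (yosida R τ x - yosida R τ y) := by
    rw [resolvent_eq hτ, resolvent_eq hτ, smul_sub]; abel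
  rw [e, inner_sub_right, inner_smul_right, real_inner_self_eq_norm_sq] at h
  linarith

theorem inner_yosida_nonneg {τ : ℝ} (hτ : 0 < τ) (x y : EuclideanSpace ℝ (Fin d)) :
    0 ≤ ⟪yosida R τ x - yosida R τ y, x - y⟫_ℝ :=
  le_trans (by positivity) (hR.mul_norm_yosida_sub_sq_le hτ x y)

theorem norm_yosida_sub_le {τ : ℝ} (hτ : 0 < τ) (x y : EuclideanSpace ℝ (Fin d)) :
    ‖yosida R τ x - yosida R τ y‖ ≤ τ⁻¹ * ‖x - y‖ := by
  have h := (hR.mul_norm_yosida_sub_sq_le hτ x y).trans (real_inner_le_norm _ _)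
  rw [inv_mul_eq_div, le_div_iff₀ hτ]
  by_cases h0 : ‖yosida R τ x - yosida R τ y‖ = 0
  · rw [h0, zero_mul]; positivity
  · have hpos : 0 < ‖yosida R τ x - yosida R τ y‖ := lt_of_le_of_ne (norm_nonneg _) (Ne.symm h0)
    refine le_of_mul_le_mul_left ?_ hpos
    linarith

theorem lipschitzWith_yosida {τ : ℝ} (hτ : 0 < τ) :
    LipschitzWith ⟨τ⁻¹, (inv_pos.2 hτ).le⟩ (yosida R τ) :=
  LipschitzWith.of_dist_le_mul fun x y => by
    rw [dist_eq_norm, dist_eq_norm]; exact hR.norm_yosida_sub_le hτ x y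

/-- Two Yosida approximations of different parameters are almost monotone with respect to each
other. -/
theorem neg_le_inner_yosida {τ σ : ℝ} (hτ : 0 < τ) (hσ : 0 < σ)
    (x y : EuclideanSpace ℝ (Fin d)) :
    -((τ + σ) / 2 * (‖yosida R τ x‖ ^ 2 + ‖yosida R σ y‖ ^ 2)) ≤
      ⟪yosida R τ x - yosida R σ y, x - y⟫_ℝ := by
  have h := hR.inner_subdiff_nonneg (hR.yosida_mem_subdiff hτ x) (hR.yosida_mem_subdiff hσ y)
  set a := yosida R τ x
  set b := yosida R σ y
  have e : resolvent R τ x - resolvent R σ y = (x - y) - (τ • a - σ • b) := by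
    rw [resolvent_eq hτ, resolvent_eq hσ]; abel
  rw [e, inner_sub_right (a - b) (x - y)] at h
  -- The diagonal terms are nonnegative and are dropped; only the cross term `(τ + σ)⟪a, b⟫` costs
  -- anything.
  have e2 : ⟪a - b, τ • a - σ • b⟫_ℝ = τ * ‖a‖ ^ 2 + σ * ‖b‖ ^ 2 - (τ + σ) * ⟪a, b⟫_ℝ := by
    simp only [inner_sub_left, inner_sub_right, inner_smul_right, real_inner_self_eq_norm_sq,
      real_inner_comm a b]
    ring
  have h3 := (real_inner_le_norm a b)
  have h4 : ⟪a, b⟫_ℝ ≤ (‖a‖ ^ 2 + ‖b‖ ^ 2) / 2 := by nlinarith [sq_nonneg (‖a‖ - ‖b‖)]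
  have h5 : (τ + σ) * ⟪a, b⟫_ℝ ≤ (τ + σ) * ((‖a‖ ^ 2 + ‖b‖ ^ 2) / 2) := by gcongr
  have h6 : 0 ≤ τ * ‖a‖ ^ 2 + σ * ‖b‖ ^ 2 := by positivity
  linarith

end IsRegularizer

/-- The Moreau envelope of `R`. -/
noncomputable def moreau (R : EuclideanSpace ℝ (Fin d) → EReal) (τ : ℝ)
    (x : EuclideanSpace ℝ (Fin d)) : ℝ :=
  (R (resolvent R τ x)).toReal + τ / 2 * ‖yosida R τ x‖ ^ 2

namespace IsRegularizer

variable (hR : IsRegularizer R)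
include hR

theorem resolvent_ne_top {τ : ℝ} (hτ : 0 < τ) (x : EuclideanSpace ℝ (Fin d)) :
    R (resolvent R τ x) ≠ ⊤ :=
  hR.ne_top_of_mem_subdiff (hR.yosida_mem_subdiff hτ x)

/-- The subgradient inequality between the two resolvent points, with slack `τ/2 ‖b - a‖²` after
completing the square. -/
theorem moreau_add_inner_le {τ : ℝ} (hτ : 0 < τ) (x y : EuclideanSpace ℝ (Fin d)) :
    moreau R τ x + ⟪yosida R τ x, y - x⟫_ℝ ≤ moreau R τ y := by
  have h := hR.toReal_add_inner_le (hR.yosida_mem_subdiff hτ x) (hR.resolvent_ne_top hτ y)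
  set a := yosida R τ x with ha
  set b := yosida R τ y with hb
  have e : resolvent R τ y - resolvent R τ x = (y - x) - τ • (b - a) := by
    rw [resolvent_eq hτ, resolvent_eq hτ, smul_sub]; abel
  rw [e, inner_sub_right a (y - x), inner_smul_right, inner_sub_right a b,
    real_inner_self_eq_norm_sq] at h
  have h2 : ‖b - a‖ ^ 2 = ‖b‖ ^ 2 - 2 * ⟪a, b⟫_ℝ + ‖a‖ ^ 2 := by
    rw [norm_sub_sq_real, real_inner_comm]
  have h3 : 0 ≤ τ / 2 * ‖b - a‖ ^ 2 := by positivity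
  rw [h2] at h3
  simp only [moreau, ← ha, ← hb]
  nlinarith

/-- Moving the base point from the resolvent back to `x` only drops `τ‖yosida‖² ≥ 0`. This is the
inequality that passes to the limit `τ ↓ 0`. -/
theorem toReal_resolvent_add_inner_le {τ : ℝ} (hτ : 0 < τ) (x : EuclideanSpace ℝ (Fin d))
    {z : EuclideanSpace ℝ (Fin d)} (hz : R z ≠ ⊤) :
    (R (resolvent R τ x)).toReal + ⟪yosida R τ x, z - x⟫_ℝ ≤ (R z).toReal := by
  have h := hR.toReal_add_inner_le (hR.yosida_mem_subdiff hτ x) hz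
  have e : z - resolvent R τ x = (z - x) + τ • yosida R τ x := by rw [resolvent_eq hτ]; abel
  rw [e, inner_add_right, inner_smul_right, real_inner_self_eq_norm_sq] at h
  have : 0 ≤ τ * ‖yosida R τ x‖ ^ 2 := by positivity
  linarith

/-- Makes the initial energy bounded independently of `τ` when `R` is finite at the initial mean. -/
theorem moreau_le {τ : ℝ} (hτ : 0 < τ) {x : EuclideanSpace ℝ (Fin d)} (hx : R x ≠ ⊤) :
    moreau R τ x ≤ (R x).toReal := by
  have h := hR.toReal_add_inner_le (hR.yosida_mem_subdiff hτ x) hx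
  have e : x - resolvent R τ x = τ • yosida R τ x := by rw [resolvent_eq hτ]; abel
  rw [e, inner_smul_right, real_inner_self_eq_norm_sq] at h
  have : 0 ≤ τ / 2 * ‖yosida R τ x‖ ^ 2 := by positivity
  rw [moreau]
  linarith

/-- The subgradient inequalities at `x` and at `y` trap the remainder between `0` and `⟪yosida y -
yosida x, y - x⟫`, which is quadratic because the Yosida approximation is `τ⁻¹`-Lipschitz. -/
theorem hasFDerivAt_moreau {τ : ℝ} (hτ : 0 < τ) (x : EuclideanSpace ℝ (Fin d)) :
    HasFDerivAt (moreau R τ) (innerSL ℝ (yosida R τ x)) x := by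
  rw [hasFDerivAt_iff_isLittleO]
  have hbig : (fun y => moreau R τ y - moreau R τ x - innerSL ℝ (yosida R τ x) (y - x)) =O[𝓝 x]
      fun y => ‖y - x‖ ^ 2 := by
    refine Asymptotics.IsBigO.of_bound τ⁻¹ (Eventually.of_forall fun y => ?_)
    have h1 := hR.moreau_add_inner_le hτ x y
    have h2 := hR.moreau_add_inner_le hτ y x
    have h3 : ⟪yosida R τ y - yosida R τ x, y - x⟫_ℝ ≤ τ⁻¹ * ‖y - x‖ ^ 2 := by
      refine (real_inner_le_norm _ _).trans ?_
      have := hR.norm_yosida_sub_le hτ y x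
      calc _ ≤ τ⁻¹ * ‖y - x‖ * ‖y - x‖ := by gcongr
        _ = _ := by ring
    rw [inner_sub_left] at h3
    rw [← neg_sub y x, inner_neg_right] at h2
    rw [innerSL_apply_apply, Real.norm_of_nonneg (by linarith), Real.norm_of_nonneg (by positivity)]
    linarith
  refine hbig.trans_isLittleO ?_
  have := Asymptotics.isLittleO_pow_sub_sub x one_lt_two
  simpa using this

end IsRegularizer

end Convex

end SEKI

/-! ### The covariance and the deviations -/

namespace SEKI

section Deviations

variable {E : Type*} [NormedAddCommGroup E] [InnerProductSpace ℝ E] {ι : Type*} [Fintype ι]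

/-- The operator `v ↦ r ∑ᵢ ⟪eᵢ, v⟫ eᵢ`. -/
noncomputable def covOp (r : ℝ) (e : ι → E) : E →L[ℝ] E :=
  r • ∑ i, (innerSL ℝ (e i)).smulRight (e i)

theorem covOp_apply (r : ℝ) (e : ι → E) (v : E) : covOp r e v = r • ∑ i, ⟪e i, v⟫_ℝ • e i := by
  simp [covOp]

theorem inner_covOp (r : ℝ) (e : ι → E) (u v : E) :
    ⟪covOp r e u, v⟫_ℝ = ⟪u, covOp r e v⟫_ℝ := by
  simp only [covOp_apply, inner_smul_left, inner_smul_right, sum_inner, inner_sum]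
  refine congrArg _ (Finset.sum_congr rfl fun i _ => ?_)
  rw [real_inner_comm u (e i)]
  exact mul_comm _ _

theorem continuousOn_covOp (r : ℝ) {e : ι → ℝ → E} {s : Set ℝ} (he : ∀ i, ContinuousOn (e i) s) :
    ContinuousOn (fun t => covOp r fun i => e i t) s := by
  unfold covOp
  refine ContinuousOn.const_smul (continuousOn_finsetSum _ fun i _ => ?_) r
  have h1 : ContinuousOn (fun t => innerSL ℝ (e i t)) s :=
    (innerSL ℝ).continuous.comp_continuousOn (he i)
  exact (isBoundedBilinearMap_smulRight (𝕜 := ℝ)).continuous.comp_continuousOn (h1.prodMk (he i))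

/-- The inverse covariance `Q₀ + 2 t H` at time `t`. -/
noncomputable def precision (Q₀ H : E →L[ℝ] E) (t : ℝ) : E →L[ℝ] E := Q₀ + (2 * t) • H

theorem precision_apply (Q₀ H : E →L[ℝ] E) (t : ℝ) (v : E) :
    precision Q₀ H t v = Q₀ v + (2 * t) • H v := rfl

@[simp]
theorem precision_zero (Q₀ H : E →L[ℝ] E) : precision Q₀ H 0 = Q₀ := by simp [precision]

theorem continuous_precision (Q₀ H : E →L[ℝ] E) : Continuous (precision Q₀ H) := by
  unfold precision; fun_prop

theorem hasDerivWithinAt_precision_apply (Q₀ H : E →L[ℝ] E) {f : ℝ → E} {f' : E} {s : Set ℝ}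
    {t : ℝ} (hf : HasDerivWithinAt f f' s t) :
    HasDerivWithinAt (fun t => precision Q₀ H t (f t))
      (precision Q₀ H t f' + (2 : ℝ) • H (f t)) s t := by
  have h2 : HasDerivWithinAt (fun t : ℝ => 2 * t) 2 s t := by
    simpa using (hasDerivWithinAt_id t s).const_mul 2
  have h := (Q₀.hasFDerivAt.comp_hasDerivWithinAt t hf).add
    (h2.smul (H.hasFDerivAt.comp_hasDerivWithinAt t hf))
  refine h.congr_deriv ?_
  rw [precision_apply]
  simp only [Function.comp_apply]
  abel

/-- Product rule for `C' = -(CHG + GHC)`; symmetry moves `G` and `H` across the inner product. Here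
`G` is the coefficient frozen at time `t`; taking the covariance itself gives `C' = -2CHC`. -/
theorem hasDerivWithinAt_covOp_apply {r : ℝ} {e : ι → ℝ → E} {G H : E →L[ℝ] E}
    (hG : ∀ u v, ⟪G u, v⟫_ℝ = ⟪u, G v⟫_ℝ) (hH : ∀ u v, ⟪H u, v⟫_ℝ = ⟪u, H v⟫_ℝ)
    {u : ℝ → E} {u' : E} {s : Set ℝ} {t : ℝ}
    (he : ∀ i, HasDerivWithinAt (e i) (-(G (H (e i t)))) s t) (hu : HasDerivWithinAt u u' s t) :
    HasDerivWithinAt (fun t => covOp r (fun i => e i t) (u t))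
      (covOp r (fun i => e i t) u' - covOp r (fun i => e i t) (H (G (u t)))
        - G (H (covOp r (fun i => e i t) (u t)))) s t := by
  simp only [covOp_apply]
  have h := (HasDerivWithinAt.fun_sum (u := Finset.univ) fun i _ =>
    ((he i).inner ℝ hu).smul (he i)).const_smul r
  refine h.congr_deriv ?_
  simp only [map_smul, map_sum, ← smul_sub, ← Finset.sum_sub_distrib]
  refine congrArg _ (Finset.sum_congr rfl fun i _ => ?_)
  rw [inner_neg_left, hG, hH, add_smul, smul_neg, neg_smul]
  abel

theorem ac_precision_apply (Q₀ H : E →L[ℝ] E) {T : ℝ} {f : ℝ → E}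
    (hf : AbsolutelyContinuousOnInterval f 0 T) :
    AbsolutelyContinuousOnInterval (fun t => precision Q₀ H t (f t)) 0 T := by
  simp only [precision_apply]
  have h2 : AbsolutelyContinuousOnInterval (fun t : ℝ => 2 * t) 0 T :=
    ContDiffOn.absolutelyContinuousOnInterval (by fun_prop)
  exact (hf.clm_apply Q₀).fun_add (h2.fun_smul (hf.clm_apply H))

/-- The deviation equations determine the covariance: its inverse grows linearly in time. -/
theorem covOp_precision_of_ac {r T : ℝ} {Q₀ H : E →L[ℝ] E} {e : ι → ℝ → E}
    (hH : ∀ u v, ⟪H u, v⟫_ℝ = ⟪u, H v⟫_ℝ)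
    (hac : ∀ i, AbsolutelyContinuousOnInterval (e i) 0 T)
    (hd : ∀ᵐ t ∂(volume.restrict (Icc (0 : ℝ) T)),
      ∀ i, HasDerivAt (e i) (-(covOp r (fun i => e i t) (H (e i t)))) t)
    (h0 : ∀ v, covOp r (fun i => e i 0) (Q₀ v) = v) {t : ℝ} (ht : t ∈ Icc 0 T) (v : E) :
    covOp r (fun i => e i t) (precision Q₀ H t v) = v := by
  have hT : 0 ≤ T := ht.1.trans ht.2
  obtain ⟨L, hL⟩ := isCompact_Icc.exists_bound_of_continuousOn
    (continuousOn_covOp r (s := Icc 0 T) fun i => by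
      have := (hac i).continuousOn
      rwa [uIcc_of_le hT] at this)
  have hconst : AbsolutelyContinuousOnInterval (fun _ : ℝ => v) 0 T :=
    ((LipschitzWith.const v : LipschitzWith 0 fun _ : ℝ =>
      v).lipschitzOnWith).absolutelyContinuousOnInterval
  have hQv := ac_precision_apply Q₀ H hconst
  have hcQ : AbsolutelyContinuousOnInterval
      (fun t => covOp r (fun i => e i t) (precision Q₀ H t v)) 0 T := by
    simp only [covOp_apply]
    exact (AbsolutelyContinuousOnInterval.finset_sum Finset.univ fun i _ =>
      ((hac i).inner hQv).fun_smul (hac i)).const_smul r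
  have hw := hconst.fun_sub hcQ
  -- The defect `w = v - CQv` starts at zero and solves `w' = -2CHw`, so Grönwall keeps it zero.
  -- Invertibility of `C` at later times is a conclusion, not an input.
  have hz := hw.eq_zero_of_ae_norm_deriv_le (L := 2 * (L * ‖H‖)) (by
    filter_upwards [hd, ae_restrict_mem measurableSet_Icc] with s hs hsm
    have hu := hasDerivWithinAt_precision_apply Q₀ H (hasDerivWithinAt_const s univ v)
    have hc := hasDerivWithinAt_covOp_apply (r := r) (inner_covOp r fun i => e i s) hH
      (fun i => (hs i).hasDerivWithinAt) hu
    refine ⟨_, ((hasDerivWithinAt_const s univ v).sub hc).hasDerivAt univ_mem, ?_⟩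
    set c := covOp r fun i => e i s
    set w := v - c (precision Q₀ H s v) with hwdef
    have e1 : 0 - (c (precision Q₀ H s 0 + (2 : ℝ) • H v) - c (H (c (precision Q₀ H s v)))
        - c (H (c (precision Q₀ H s v)))) = -((2 : ℝ) • c (H w)) := by
      rw [hwdef]
      simp only [map_sub, map_add, map_zero, zero_add, smul_sub, two_smul]
      abel
    rw [e1, norm_neg, norm_smul, Real.norm_ofNat, mul_assoc]
    have h1 : ‖c (H w)‖ ≤ L * (‖H‖ * ‖w‖) :=
      (c.le_opNorm _).trans (mul_le_mul (hL s hsm) (H.le_opNorm _) (norm_nonneg _)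
        ((norm_nonneg _).trans (hL s hsm)))
    linarith) (by simp [h0]) ht
  exact (sub_eq_zero.1 hz).symm

/-- Uniqueness for the linear deviation equation. -/
theorem eqOn_of_linear_ac {T L : ℝ} {C : ℝ → E →L[ℝ] E} {H : E →L[ℝ] E} {f g : ℝ → E}
    (hf : AbsolutelyContinuousOnInterval f 0 T) (hg : AbsolutelyContinuousOnInterval g 0 T)
    (hL : ∀ t ∈ Icc (0 : ℝ) T, ‖C t‖ ≤ L)
    (hf' : ∀ᵐ t ∂(volume.restrict (Icc (0 : ℝ) T)), HasDerivAt f (-(C t (H (f t)))) t)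
    (hg' : ∀ᵐ t ∂(volume.restrict (Icc (0 : ℝ) T)), HasDerivAt g (-(C t (H (g t)))) t)
    (h0 : f 0 = g 0) : EqOn f g (Icc 0 T) := by
  intro t ht
  have hz := (hf.fun_sub hg).eq_zero_of_ae_norm_deriv_le (L := L * ‖H‖) (by
    filter_upwards [hf', hg', ae_restrict_mem measurableSet_Icc] with s hs hs' hsm
    refine ⟨_, hs.sub hs', ?_⟩
    have e1 : -(C s (H (f s))) - -(C s (H (g s))) = -(C s (H (f s - g s))) := by
      simp only [map_sub]; abel
    rw [e1, norm_neg, mul_assoc]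
    exact ((C s).le_opNorm _).trans (mul_le_mul (hL s hsm) (H.le_opNorm _) (norm_nonneg _)
        ((norm_nonneg _).trans (hL s hsm)))) (by simp [h0]) ht
  exact sub_eq_zero.1 hz

/-- Existence of a linear flow for the deviation equations, the covariance being the inverse of `precision`. -/
theorem exists_deviations [FiniteDimensional ℝ E] {r T : ℝ} (hT₀ : 0 < T) {Q₀ H : E →L[ℝ] E}
    {C : ℝ → E →L[ℝ] E} (hH : ∀ u v, ⟪H u, v⟫_ℝ = ⟪u, H v⟫_ℝ)
    (hQ₀ : ∀ u v, ⟪Q₀ u, v⟫_ℝ = ⟪u, Q₀ v⟫_ℝ) (hC : ContinuousOn C (Icc 0 T))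
    (hCQ : ∀ t ∈ Icc 0 T, ∀ v, C t (precision Q₀ H t v) = v)
    (hQC : ∀ t ∈ Icc 0 T, ∀ v, precision Q₀ H t (C t v) = v)
    (e₀ : ι → E) (he₀ : ∀ v, covOp r e₀ (Q₀ v) = v) :
    ∃ M : ℝ → E →L[ℝ] E, M 0 = ContinuousLinearMap.id ℝ E ∧
      (∀ v, ∀ t ∈ Icc 0 T,
        HasDerivWithinAt (fun t => M t v) (-(C t (H (M t v)))) (Icc 0 T) t) ∧
      ∀ t ∈ Icc 0 T, covOp r (fun i => M t (e₀ i)) = C t := by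
  have hT := hT₀.le
  obtain ⟨L, hL⟩ := isCompact_Icc.exists_bound_of_continuousOn hC
  have hL0 : 0 ≤ L := (norm_nonneg _).trans (hL 0 ⟨le_rfl, hT⟩)
  have hQsym : ∀ t u v, ⟪precision Q₀ H t u, v⟫_ℝ = ⟪u, precision Q₀ H t v⟫_ℝ := fun t u v => by
    simp only [precision_apply, inner_add_left, inner_add_right, real_inner_smul_left,
      real_inner_smul_right, hH, hQ₀]
  -- With `C` prescribed the equation is linear, and a single operator `M` moves all deviations at
  -- once.
  obtain ⟨M, hM0, hM⟩ := exists_hasDerivWithinAt_of_lipschitz (E := E →L[ℝ] E)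
    (f := fun t (M : E →L[ℝ] E) => -((C t ∘L H) ∘L M)) hT (K := ⟨L * ‖H‖, by positivity⟩)
    (fun t ht => LipschitzWith.of_dist_le_mul fun M N => by
      rw [dist_eq_norm, dist_eq_norm]
      have e1 : -((C t ∘L H) ∘L M) - -((C t ∘L H) ∘L N) = -((C t ∘L H) ∘L (M - N)) := by
        rw [ContinuousLinearMap.comp_sub]; abel
      rw [e1, norm_neg]
      refine (ContinuousLinearMap.opNorm_comp_le _ _).trans ?_
      refine mul_le_mul_of_nonneg_right ?_ (norm_nonneg _)
      exact (ContinuousLinearMap.opNorm_comp_le _ _).trans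
        (mul_le_mul_of_nonneg_right (hL t ht) (norm_nonneg _)))
    (fun M => ((hC.clm_comp continuousOn_const).clm_comp continuousOn_const).neg)
    (ContinuousLinearMap.id ℝ E)
  have hMv : ∀ v, ∀ t ∈ Icc 0 T,
      HasDerivWithinAt (fun t => M t v) (-(C t (H (M t v)))) (Icc 0 T) t := fun v t ht => by
    simpa using (hM t ht).clm_apply (hasDerivWithinAt_const t _ v)
  -- `M` carries the form of `Q₀` to that of `Q(t)`: `Q' = 2H` contributes `2⟪HMu, Mv⟫`, and each
  -- factor `M' = -CHM` removes one copy.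
  have hinv : ∀ u v, ∀ t ∈ Icc 0 T, ⟪precision Q₀ H t (M t u), M t v⟫_ℝ = ⟪Q₀ u, v⟫_ℝ := by
    intro u v t ht
    have hd : ∀ s ∈ Icc 0 T,
        HasDerivWithinAt (fun t => ⟪precision Q₀ H t (M t u), M t v⟫_ℝ) 0 (Icc 0 T) s := by
      intro s hs
      have h := (hasDerivWithinAt_precision_apply Q₀ H (hMv u s hs)).inner ℝ (hMv v s hs)
      refine h.congr_deriv ?_
      rw [map_neg, hQC s hs, inner_neg_right, inner_add_left, inner_neg_left, hQsym, hQC s hs,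
        real_inner_smul_left, ← hH]
      ring
    have := (convex_Icc 0 T).is_const_of_fderivWithin_eq_zero (𝕜 := ℝ)
      (fun s hs => (hd s hs).differentiableWithinAt)
      (fun s hs => by
        have h1 := (hd s hs).hasFDerivWithinAt.fderivWithin (uniqueDiffOn_Icc hT₀ s hs)
        rw [h1]; ext; simp) ht ⟨le_rfl, hT⟩
    rw [this]
    simp [hM0]
  have hsurj : ∀ t ∈ Icc 0 T, Function.Surjective (M t) := by
    intro t ht
    refine (LinearMap.injective_iff_surjective (f := (M t : E →ₗ[ℝ] E))).1 ?_
    rw [injective_iff_map_eq_zero]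
    intro u hu
    have h1 := hinv u (Q₀ u) t ht
    have hu' : M t u = 0 := hu
    rw [hu', map_zero, inner_zero_left] at h1
    have h2 : Q₀ u = 0 := inner_self_eq_zero.1 h1.symm
    have h3 := hCQ 0 ⟨le_rfl, hT⟩ u
    rw [precision_zero, h2, map_zero] at h3
    exact h3.symm
  refine ⟨M, hM0, hMv, fun t ht => ?_⟩
  -- Every vector is `Mu`, and by the invariance the covariance of the moved deviations sends `QMu`
  -- to `M` applied to the initial covariance of `Q₀u`, that is, to `Mu`.
  have hcQ : ∀ v, covOp r (fun i => M t (e₀ i)) (precision Q₀ H t v) = v := by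
    intro v
    obtain ⟨u, rfl⟩ := hsurj t ht v
    rw [covOp_apply]
    have : ∀ i, ⟪M t (e₀ i), precision Q₀ H t (M t u)⟫_ℝ = ⟪e₀ i, Q₀ u⟫_ℝ := fun i => by
      rw [← hQsym, hinv _ _ t ht, hQ₀]
    simp only [this]
    conv_rhs => rw [← he₀ u, covOp_apply]
    simp
  ext1 v
  conv_lhs => rw [← hQC t ht v]
  exact hcQ _

end Deviations

end SEKI

/-! ### The dynamics of the mean -/

namespace SEKI

/-- Two symmetric coercive operators, with coercivity constants. -/
structure IsCoercivePair {E : Type*} [NormedAddCommGroup E] [InnerProductSpace ℝ E]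
    (Q₀ H : E →L[ℝ] E) (q h : ℝ) : Prop where
  q_pos : 0 < q
  h_pos : 0 < h
  symm_left : ∀ u v, ⟪Q₀ u, v⟫_ℝ = ⟪u, Q₀ v⟫_ℝ
  symm_right : ∀ u v, ⟪H u, v⟫_ℝ = ⟪u, H v⟫_ℝ
  coercive_left : ∀ v, q * ‖v‖ ^ 2 ≤ ⟪Q₀ v, v⟫_ℝ
  coercive_right : ∀ v, h * ‖v‖ ^ 2 ≤ ⟪H v, v⟫_ℝ

section Mean

variable {E : Type*} [NormedAddCommGroup E] [InnerProductSpace ℝ E] {Q₀ H : E →L[ℝ] E} {q h : ℝ}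

namespace IsCoercivePair

variable (hp : IsCoercivePair Q₀ H q h)
include hp

theorem inner_right_nonneg (v : E) : 0 ≤ ⟪H v, v⟫_ℝ :=
  le_trans (mul_nonneg hp.h_pos.le (sq_nonneg _)) (hp.coercive_right v)

theorem inner_precision_symm (t : ℝ) (u v : E) :
    ⟪precision Q₀ H t u, v⟫_ℝ = ⟪u, precision Q₀ H t v⟫_ℝ := by
  simp only [precision_apply, inner_add_left, inner_add_right, real_inner_smul_left,
    real_inner_smul_right, hp.symm_left, hp.symm_right]

theorem coercive_precision {t : ℝ} (ht : 0 ≤ t) (v : E) :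
    q * ‖v‖ ^ 2 ≤ ⟪precision Q₀ H t v, v⟫_ℝ := by
  rw [precision_apply, inner_add_left, real_inner_smul_left]
  have := mul_nonneg (mul_nonneg zero_le_two ht) (hp.inner_right_nonneg v)
  linarith [hp.coercive_left v]

/-- The term `⟪Hf, f⟫` comes from `Q' = 2H`; it offsets the linear term of the mean equation. -/
theorem hasDerivWithinAt_inner_precision {f : ℝ → E} {f' : E} {s : Set ℝ} {t : ℝ}
    (hf : HasDerivWithinAt f f' s t) :
    HasDerivWithinAt (fun t => ⟪precision Q₀ H t (f t), f t⟫_ℝ)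
      (2 * (⟪precision Q₀ H t f', f t⟫_ℝ + ⟪H (f t), f t⟫_ℝ)) s t := by
  refine ((hasDerivWithinAt_precision_apply Q₀ H hf).inner ℝ hf).congr_deriv ?_
  rw [inner_add_left, real_inner_smul_left, hp.inner_precision_symm t (f t) f',
    real_inner_comm (precision Q₀ H t f') (f t)]
  ring

/-- Contraction in the time-dependent metric for evolutions driven by monotone operators. -/
theorem contraction {T : ℝ} {b : E} {m n : ℝ → E} (hm : AbsolutelyContinuousOnInterval m 0 T)
    (hn : AbsolutelyContinuousOnInterval n 0 T)
    (hd : ∀ᵐ t ∂(volume.restrict (Icc (0 : ℝ) T)), ∃ v w ξ η : E, HasDerivAt m v t ∧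
      HasDerivAt n w t ∧ precision Q₀ H t v + H (m t) + ξ = b ∧
      precision Q₀ H t w + H (n t) + η = b ∧ 0 ≤ ⟪ξ - η, m t - n t⟫_ℝ)
    {t : ℝ} (ht : t ∈ Icc 0 T) :
    ⟪precision Q₀ H t (m t - n t), m t - n t⟫_ℝ ≤ ⟪Q₀ (m 0 - n 0), m 0 - n 0⟫_ℝ := by
  have hac := (ac_precision_apply Q₀ H (hm.fun_sub hn)).inner (hm.fun_sub hn)
  have := hac.le_of_ae_deriv_nonpos (by
    filter_upwards [hd] with s hs
    obtain ⟨v, w, ξ, η, hv, hw, h1, h2, h3⟩ := hs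
    refine ⟨_, ?_, (hp.hasDerivWithinAt_inner_precision
      (hv.sub hw).hasDerivWithinAt).hasDerivAt univ_mem⟩
    have e1 : precision Q₀ H s (v - w) = -(H (m s - n s)) - (ξ - η) := by
      rw [map_sub, map_sub, eq_sub_of_add_eq (eq_sub_of_add_eq h1),
        eq_sub_of_add_eq (eq_sub_of_add_eq h2)]
      abel
    simp only [Pi.sub_apply]
    rw [e1, inner_sub_left, inner_neg_left]
    linarith) ht
  simpa using this

end IsCoercivePair

end Mean

/-! ### Energy bounds and the Cauchy estimate for the regularized mean -/

section YosidaMean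

variable {d : ℕ} {R : EuclideanSpace ℝ (Fin d) → EReal}
  {Q₀ H : EuclideanSpace ℝ (Fin d) →L[ℝ] EuclideanSpace ℝ (Fin d)} {q h : ℝ}
  {b : EuclideanSpace ℝ (Fin d)} {τ T : ℝ}

/-- `m` solves, with velocity `v`, the regularized mean equation in precision form. -/
structure IsYosidaMean (R : EuclideanSpace ℝ (Fin d) → EReal)
    (Q₀ H : EuclideanSpace ℝ (Fin d) →L[ℝ] EuclideanSpace ℝ (Fin d))
    (b : EuclideanSpace ℝ (Fin d)) (τ T : ℝ) (m v : ℝ → EuclideanSpace ℝ (Fin d)) : Prop where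
  deriv : ∀ t ∈ Icc 0 T, HasDerivWithinAt m (v t) (Icc 0 T) t
  eq : ∀ t ∈ Icc 0 T, precision Q₀ H t (v t) + H (m t) + yosida R τ (m t) = b
  cont : ContinuousOn v (Icc 0 T)

theorem exists_isYosidaMean (hR : IsRegularizer R) (hτ : 0 < τ) (hT : 0 ≤ T)
    {C : ℝ → EuclideanSpace ℝ (Fin d) →L[ℝ] EuclideanSpace ℝ (Fin d)}
    (hC : ContinuousOn C (Icc 0 T)) (hQC : ∀ t ∈ Icc 0 T, ∀ v, precision Q₀ H t (C t v) = v)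
    (b m₀ : EuclideanSpace ℝ (Fin d)) :
    ∃ m, m 0 = m₀ ∧
      IsYosidaMean R Q₀ H b τ T m (fun t => C t (b - H (m t) - yosida R τ (m t))) := by
  obtain ⟨L, hL⟩ := isCompact_Icc.exists_bound_of_continuousOn hC
  have hL0 : 0 ≤ L := (norm_nonneg _).trans (hL 0 ⟨le_rfl, hT⟩)
  have hlip := hR.lipschitzWith_yosida hτ
  obtain ⟨m, hm0, hm⟩ := exists_hasDerivWithinAt_of_lipschitz
    (f := fun t x => C t (b - H x - yosida R τ x)) hT
    (K := ⟨L, hL0⟩ * (0 + ‖H‖₊ + ⟨τ⁻¹, (inv_pos.2 hτ).le⟩))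
    (fun t ht => by
      have hCl : LipschitzWith ⟨L, hL0⟩ (C t) := (C t).lipschitz.weaken (hL t ht)
      exact hCl.comp (((LipschitzWith.const b).sub H.lipschitz).sub hlip))
    (fun x => hC.clm_apply continuousOn_const) m₀
  have hmc : ContinuousOn m (Icc 0 T) := fun t ht => (hm t ht).continuousWithinAt
  refine ⟨m, hm0, hm, fun t ht => ?_, ?_⟩
  · rw [hQC t ht]; abel
  · exact hC.clm_apply ((continuousOn_const.sub (H.continuous.comp_continuousOn hmc)).sub
      (hlip.continuous.comp_continuousOn hmc))

/-- The energy functional of the regularized mean dynamics. -/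
noncomputable def energy (R : EuclideanSpace ℝ (Fin d) → EReal)
    (H : EuclideanSpace ℝ (Fin d) →L[ℝ] EuclideanSpace ℝ (Fin d))
    (b : EuclideanSpace ℝ (Fin d)) (τ : ℝ) (x : EuclideanSpace ℝ (Fin d)) : ℝ :=
  moreau R τ x + 1 / 2 * ⟪H x, x⟫_ℝ - ⟪b, x⟫_ℝ

/-- Coercivity of `H` supplies `h/2 ‖x‖²`; half of it absorbs the linear term by Young's inequality.
-/
theorem IsCoercivePair.energy_ge (hp : IsCoercivePair Q₀ H q h)
    (b : EuclideanSpace ℝ (Fin d)) (x : EuclideanSpace ℝ (Fin d)) :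
    (R (resolvent R τ x)).toReal + τ / 2 * ‖yosida R τ x‖ ^ 2 + h / 4 * ‖x‖ ^ 2
      - ‖b‖ ^ 2 / h ≤ energy R H b τ x := by
  have h1 := hp.coercive_right x
  have h2 := real_inner_le_norm b x
  have h3 : ‖b‖ * ‖x‖ ≤ h / 4 * ‖x‖ ^ 2 + ‖b‖ ^ 2 / h := by
    have h4 : 0 ≤ h * (‖x‖ / 2 - ‖b‖ / h) ^ 2 := mul_nonneg hp.h_pos.le (sq_nonneg _)
    have h5 : h * (‖x‖ / 2 - ‖b‖ / h) ^ 2 = h / 4 * ‖x‖ ^ 2 + ‖b‖ ^ 2 / h - ‖b‖ * ‖x‖ := by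
      have := hp.h_pos.ne'
      field_simp
      ring
    linarith
  simp only [energy, moreau]
  linarith

namespace IsYosidaMean

variable {m v : ℝ → EuclideanSpace ℝ (Fin d)}

/-- The gradient of the energy at `m` is `yosida + Hm - b = -Qv`: the motion is steepest descent for
the metric `Q`. -/
theorem hasDerivWithinAt_energy (hm : IsYosidaMean R Q₀ H b τ T m v) (hR : IsRegularizer R)
    (hτ : 0 < τ) (hp : IsCoercivePair Q₀ H q h) {t : ℝ} (ht : t ∈ Icc 0 T) :
    HasDerivWithinAt (fun t => energy R H b τ (m t)) (-⟪precision Q₀ H t (v t), v t⟫_ℝ)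
      (Icc 0 T) t := by
  have hd := hm.deriv t ht
  have h1 := (hR.hasFDerivAt_moreau hτ (m t)).comp_hasDerivWithinAt t hd
  have h2 := ((H.hasFDerivAt.comp_hasDerivWithinAt t hd).inner ℝ hd).const_mul (1 / 2 : ℝ)
  have h3 := (hasDerivWithinAt_const t (Icc 0 T) b).inner ℝ hd
  refine ((h1.add h2).sub h3).congr_deriv ?_
  have e : precision Q₀ H t (v t) = b - H (m t) - yosida R τ (m t) := by
    rw [← hm.eq t ht]; abel
  rw [e]
  simp only [innerSL_apply_apply, Function.comp_apply, inner_zero_left, add_zero, inner_sub_left]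
  rw [hp.symm_right (v t), real_inner_comm (H (m t)) (v t)]
  ring

theorem energy_antitoneOn (hm : IsYosidaMean R Q₀ H b τ T m v) (hR : IsRegularizer R)
    (hτ : 0 < τ) (hp : IsCoercivePair Q₀ H q h) :
    AntitoneOn (fun t => energy R H b τ (m t)) (Icc 0 T) := by
  refine antitoneOn_of_hasDerivWithinAt_nonpos (convex_Icc 0 T)
    (f' := fun t => -⟪precision Q₀ H t (v t), v t⟫_ℝ)
    (fun t ht => (hm.hasDerivWithinAt_energy hR hτ hp ht).continuousWithinAt)
    (fun t ht => (hm.hasDerivWithinAt_energy hR hτ hp (interior_subset ht)).mono interior_subset)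
    fun t ht => ?_
  have h1 := hp.coercive_precision (interior_subset ht).1 (v t)
  have := mul_nonneg hp.q_pos.le (sq_nonneg ‖v t‖)
  linarith

end IsYosidaMean

/-- Bounds for the regularized mean dynamics that are uniform in the parameter `τ`. -/
theorem IsCoercivePair.exists_yosida_bounds (hp : IsCoercivePair Q₀ H q h) (hR : IsRegularizer R)
    (hT : 0 ≤ T) {m₀ : EuclideanSpace ℝ (Fin d)} (hm₀ : R m₀ ≠ ⊤) (b : EuclideanSpace ℝ (Fin d)) :
    ∃ N B K₁ K₂ : ℝ, 0 ≤ N ∧ 0 ≤ K₁ ∧ 0 ≤ K₂ ∧ ∀ τ > 0, ∀ m v,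
      IsYosidaMean R Q₀ H b τ T m v → m 0 = m₀ → ∀ t ∈ Icc 0 T,
        energy R H b τ (m 0) - energy R H b τ (m t) ≤ N ∧
        τ * ‖yosida R τ (m t)‖ ^ 2 ≤ 2 * N ∧
        (R (resolvent R τ (m t))).toReal ≤ B ∧
        ‖yosida R τ (m t)‖ ^ 2 ≤ K₁ * ⟪precision Q₀ H t (v t), v t⟫_ℝ + K₂ := by
  obtain ⟨r, hr⟩ := hR.exists_toReal_ge
  obtain ⟨L, hL⟩ := isCompact_Icc.exists_bound_of_continuousOn
    (continuous_precision Q₀ H).continuousOn (s := Icc 0 T)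
  have hL0 : 0 ≤ L := (norm_nonneg _).trans (hL 0 ⟨le_rfl, hT⟩)
  -- `U` bounds the initial energy for all `τ`, and `r - ‖b‖²/h` is a lower bound for the energy;
  -- `N` is their difference.
  set U : ℝ := (R m₀).toReal + 1 / 2 * ⟪H m₀, m₀⟫_ℝ - ⟪b, m₀⟫_ℝ with hU
  set N : ℝ := U - r + ‖b‖ ^ 2 / h with hN
  have hq := hp.q_pos
  have hh := hp.h_pos
  have key : ∀ τ > 0, ∀ m v, IsYosidaMean R Q₀ H b τ T m v → m 0 = m₀ → ∀ t ∈ Icc 0 T,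
      energy R H b τ (m t) ≤ U ∧ energy R H b τ (m 0) ≤ U := by
    intro τ hτ m v hm h0 t ht
    have h1 : energy R H b τ (m t) ≤ energy R H b τ (m 0) :=
      hm.energy_antitoneOn hR hτ hp ⟨le_rfl, hT⟩ ht ht.1
    have h2 : energy R H b τ (m 0) ≤ U := by
      rw [h0, energy, hU]
      linarith [hR.moreau_le hτ hm₀]
    exact ⟨h1.trans h2, h2⟩
  have hN0 : 0 ≤ N := by
    have h1 := hp.energy_ge (R := R) (τ := 1) b m₀
    have h2 : energy R H b 1 m₀ ≤ U := by
      rw [energy, hU]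
      linarith [hR.moreau_le one_pos hm₀]
    have h3 := hr _ (hR.resolvent_ne_top one_pos m₀)
    have h4 : 0 ≤ (1 : ℝ) / 2 * ‖yosida R 1 m₀‖ ^ 2 := by positivity
    have h5 : 0 ≤ h / 4 * ‖m₀‖ ^ 2 := by positivity
    linarith
  refine ⟨N, U + ‖b‖ ^ 2 / h, 2 * (L ^ 2 / q), 2 * (2 * ‖b‖ ^ 2 + 2 * (‖H‖ ^ 2 * (4 * N / h))),
    hN0, by positivity, by positivity, fun τ hτ m v hm h0 t ht => ?_⟩
  obtain ⟨h1, h2⟩ := key τ hτ m v hm h0 t ht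
  have h3 := hp.energy_ge (R := R) (τ := τ) b (m t)
  have h4 := hr _ (hR.resolvent_ne_top hτ (m t))
  have h5 : 0 ≤ τ / 2 * ‖yosida R τ (m t)‖ ^ 2 := by positivity
  have h6 : 0 ≤ h / 4 * ‖m t‖ ^ 2 := by positivity
  refine ⟨by linarith, by linarith, by linarith, ?_⟩
  have hmn : ‖m t‖ ^ 2 ≤ 4 * N / h := by
    rw [le_div_iff₀ hh]
    linarith
  -- The equation expresses the Yosida term by a bounded part, giving `K₂`, and `Qv`, whose square
  -- is at most `L²/q` times the dissipation, giving `K₁`.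
  have e : yosida R τ (m t) = (b - H (m t)) - precision Q₀ H t (v t) := by
    rw [← hm.eq t ht]; abel
  have hsq : ∀ x y : EuclideanSpace ℝ (Fin d), ‖x - y‖ ^ 2 ≤ 2 * ‖x‖ ^ 2 + 2 * ‖y‖ ^ 2 :=
    fun x y => by
      have h7 := norm_sub_le x y
      have h8 : ‖x - y‖ ^ 2 ≤ (‖x‖ + ‖y‖) ^ 2 := by gcongr
      nlinarith [sq_nonneg (‖x‖ - ‖y‖)]
  have h7 : ‖b - H (m t)‖ ^ 2 ≤ 2 * ‖b‖ ^ 2 + 2 * (‖H‖ ^ 2 * (4 * N / h)) := by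
    refine (hsq _ _).trans ?_
    have h8 : ‖H (m t)‖ ^ 2 ≤ ‖H‖ ^ 2 * ‖m t‖ ^ 2 := by
      rw [← mul_pow]
      gcongr
      exact H.le_opNorm _
    have h9 : ‖H‖ ^ 2 * ‖m t‖ ^ 2 ≤ ‖H‖ ^ 2 * (4 * N / h) := by gcongr
    linarith
  have h8 : ‖precision Q₀ H t (v t)‖ ^ 2 ≤ L ^ 2 / q * ⟪precision Q₀ H t (v t), v t⟫_ℝ := by
    have h9 : ‖precision Q₀ H t (v t)‖ ^ 2 ≤ L ^ 2 * ‖v t‖ ^ 2 := by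
      rw [← mul_pow]
      gcongr
      exact ((precision Q₀ H t).le_opNorm _).trans (by gcongr; exact hL t ht)
    have h10 : ‖v t‖ ^ 2 ≤ ⟪precision Q₀ H t (v t), v t⟫_ℝ / q := by
      rw [le_div_iff₀ hq, mul_comm]
      exact hp.coercive_precision ht.1 _
    calc _ ≤ L ^ 2 * ‖v t‖ ^ 2 := h9
      _ ≤ L ^ 2 * (⟪precision Q₀ H t (v t), v t⟫_ℝ / q) := by gcongr
      _ = _ := by ring
  rw [e]
  refine (hsq _ _).trans ?_
  linarith

/-- Cauchy estimate for the regularized mean dynamics. -/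
theorem IsCoercivePair.norm_yosidaMean_sub_sq_le (hp : IsCoercivePair Q₀ H q h)
    (hR : IsRegularizer R) {N K₁ K₂ τ σ : ℝ} (hτ : 0 < τ) (hσ : 0 < σ)
    (hK₁ : 0 ≤ K₁) {m v n w : ℝ → EuclideanSpace ℝ (Fin d)}
    (hm : IsYosidaMean R Q₀ H b τ T m v) (hn : IsYosidaMean R Q₀ H b σ T n w)
    (hmN : ∀ t ∈ Icc 0 T, energy R H b τ (m 0) - energy R H b τ (m t) ≤ N ∧
        ‖yosida R τ (m t)‖ ^ 2 ≤ K₁ * ⟪precision Q₀ H t (v t), v t⟫_ℝ + K₂)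
    (hnN : ∀ t ∈ Icc 0 T, energy R H b σ (n 0) - energy R H b σ (n t) ≤ N ∧
        ‖yosida R σ (n t)‖ ^ 2 ≤ K₁ * ⟪precision Q₀ H t (w t), w t⟫_ℝ + K₂)
    (hK₂ : 0 ≤ K₂) (h0 : m 0 = n 0) {t : ℝ} (ht : t ∈ Icc 0 T) :
    ‖m t - n t‖ ^ 2 ≤ 2 * (K₁ * N + K₂ * T) / q * (τ + σ) := by
  have hT : 0 ≤ T := ht.1.trans ht.2
  -- A Lyapunov function: the decay of the two energies pays for the `K₁` terms in the defect of
  -- monotonicity, and the linear drift for the `K₂` terms.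
  set F : ℝ → ℝ := fun t => 1 / 2 * ⟪precision Q₀ H t (m t - n t), m t - n t⟫_ℝ +
    (τ + σ) / 2 * K₁ * (energy R H b τ (m t) + energy R H b σ (n t)) - (τ + σ) * K₂ * t with hF
  have hd : ∀ s ∈ Icc 0 T, HasDerivWithinAt F
      (1 / 2 * (2 * (⟪precision Q₀ H s (v s - w s), m s - n s⟫_ℝ +
        ⟪H (m s - n s), m s - n s⟫_ℝ)) + (τ + σ) / 2 * K₁ *
        (-⟪precision Q₀ H s (v s), v s⟫_ℝ + -⟪precision Q₀ H s (w s), w s⟫_ℝ)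
        - (τ + σ) * K₂ * 1) (Icc 0 T) s := fun s hs =>
    (((hp.hasDerivWithinAt_inner_precision ((hm.deriv s hs).sub (hn.deriv s hs))).const_mul
      (1 / 2)).add (((hm.hasDerivWithinAt_energy hR hτ hp hs).add
        (hn.hasDerivWithinAt_energy hR hσ hp hs)).const_mul ((τ + σ) / 2 * K₁))).sub
      ((hasDerivWithinAt_id s _).const_mul ((τ + σ) * K₂))
  have hanti : AntitoneOn F (Icc 0 T) := by
    refine antitoneOn_of_hasDerivWithinAt_nonpos (convex_Icc 0 T)
      (fun s hs => (hd s hs).continuousWithinAt)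
      (fun s hs => (hd s (interior_subset hs)).mono interior_subset) fun s hs => ?_
    replace hs := interior_subset hs
    have e : precision Q₀ H s (v s - w s) =
        -(H (m s - n s)) - (yosida R τ (m s) - yosida R σ (n s)) := by
      rw [map_sub, map_sub, eq_sub_of_add_eq (eq_sub_of_add_eq (hm.eq s hs)),
        eq_sub_of_add_eq (eq_sub_of_add_eq (hn.eq s hs))]
      abel
    rw [e, inner_sub_left, inner_neg_left]
    have h1 := hR.neg_le_inner_yosida hτ hσ (m s) (n s)
    have h2 : (τ + σ) / 2 * (‖yosida R τ (m s)‖ ^ 2 + ‖yosida R σ (n s)‖ ^ 2) ≤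
        (τ + σ) / 2 * ((K₁ * ⟪precision Q₀ H s (v s), v s⟫_ℝ + K₂) +
          (K₁ * ⟪precision Q₀ H s (w s), w s⟫_ℝ + K₂)) := by
      have := (hmN s hs).2
      have := (hnN s hs).2
      gcongr
    linarith
  have h1 : F t ≤ F 0 := hanti ⟨le_rfl, hT⟩ ht ht.1
  simp only [hF, h0, sub_self, map_zero, inner_zero_left, mul_zero, sub_zero, zero_add] at h1
  have h2 := hp.coercive_precision ht.1 (m t - n t)
  have h3 := (hmN t ht).1
  have h4 := (hnN t ht).1
  rw [h0] at h3
  have h5 : (τ + σ) / 2 * K₁ * ((energy R H b τ (n 0) - energy R H b τ (m t)) +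
      (energy R H b σ (n 0) - energy R H b σ (n t))) ≤ (τ + σ) / 2 * K₁ * (N + N) := by gcongr
  have h6 : (τ + σ) * K₂ * t ≤ (τ + σ) * K₂ * T := by
    have := ht.2
    gcongr
  rw [div_mul_eq_mul_div, le_div_iff₀ hp.q_pos]
  linarith

end YosidaMean

end SEKI

/-! ### Passage to the limit in the regularized mean equation -/

namespace SEKI

section Limit

variable {d : ℕ} {R : EuclideanSpace ℝ (Fin d) → EReal}
  {Q₀ H : EuclideanSpace ℝ (Fin d) →L[ℝ] EuclideanSpace ℝ (Fin d)} {q h : ℝ}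
  {b : EuclideanSpace ℝ (Fin d)} {T : ℝ} {m v : ℝ → ℝ → EuclideanSpace ℝ (Fin d)}
  {x : ℝ → EuclideanSpace ℝ (Fin d)}

/-- A family which is Cauchy with rate `τ + σ` converges with rate `τ`. -/
theorem exists_limit_of_norm_sub_sq_le {K : ℝ} {s : Set ℝ}
    (hm : ∀ τ > 0, ∀ σ > 0, ∀ t ∈ s, ‖m τ t - m σ t‖ ^ 2 ≤ K * (τ + σ)) :
    ∃ x : ℝ → EuclideanSpace ℝ (Fin d), ∀ τ > 0, ∀ t ∈ s, ‖m τ t - x t‖ ^ 2 ≤ K * τ := by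
  suffices H : ∀ t ∈ s, ∃ y, ∀ τ > 0, ‖m τ t - y‖ ^ 2 ≤ K * τ by
    choose! x hx using H
    exact ⟨x, fun τ hτ t ht => hx t ht τ hτ⟩
  intro t ht
  have hK : 0 ≤ K := by
    have := (sq_nonneg _).trans (hm 1 one_pos 1 one_pos t ht)
    linarith
  have hseq : Tendsto (fun n : ℕ => 1 / ((n : ℝ) + 1)) atTop (𝓝 0) :=
    tendsto_one_div_add_atTop_nhds_zero_nat
  have hpos : ∀ n : ℕ, 0 < 1 / ((n : ℝ) + 1) := fun n => Nat.one_div_pos_of_nat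
  -- The sequence `τ = 1/(n + 1)` defines the limit; comparing an arbitrary `τ` with it removes the
  -- second parameter from the estimate.
  have hc : CauchySeq fun n : ℕ => m (1 / ((n : ℝ) + 1)) t := by
    refine cauchySeq_of_le_tendsto_0 (fun n : ℕ => √(K * (1 / ((n : ℝ) + 1) + 1 / ((n : ℝ) + 1))))
      (fun i j n hi hj => ?_) ?_
    · rw [dist_eq_norm]
      refine Real.le_sqrt_of_sq_le ((hm _ (hpos i) _ (hpos j) t ht).trans ?_)
      have := Nat.one_div_le_one_div (α := ℝ) hi
      have := Nat.one_div_le_one_div (α := ℝ) hj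
      gcongr
    · have h1 : Tendsto (fun n : ℕ => K * (1 / ((n : ℝ) + 1) + 1 / ((n : ℝ) + 1))) atTop
          (𝓝 (K * (0 + 0))) := (hseq.add hseq).const_mul K
      have := h1.sqrt
      simpa using this
  obtain ⟨y, hy⟩ := cauchySeq_tendsto_of_complete hc
  refine ⟨y, fun τ hτ => ?_⟩
  have h1 : Tendsto (fun n : ℕ => ‖m τ t - m (1 / ((n : ℝ) + 1)) t‖ ^ 2) atTop
      (𝓝 (‖m τ t - y‖ ^ 2)) := (tendsto_const_nhds.sub hy).norm.pow 2
  have h2 : Tendsto (fun n : ℕ => K * (τ + 1 / ((n : ℝ) + 1))) atTop (𝓝 (K * (τ + 0))) :=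
    (hseq.const_add τ).const_mul K
  rw [add_zero] at h2
  exact le_of_tendsto_of_tendsto' h1 h2 fun n => hm τ hτ _ (hpos n) t ht

theorem tendstoUniformlyOn_of_norm_sub_sq_le {K : ℝ} {s : Set ℝ}
    (hx : ∀ τ > 0, ∀ t ∈ s, ‖m τ t - x t‖ ^ 2 ≤ K * τ) :
    TendstoUniformlyOn m x (𝓝[>] 0) s := by
  rw [Metric.tendstoUniformlyOn_iff]
  intro ε hε
  have hlim : Tendsto (fun τ : ℝ => K * τ) (𝓝[>] 0) (𝓝 0) := by
    have : Tendsto (fun τ : ℝ => K * τ) (𝓝 0) (𝓝 (K * 0)) := (continuous_const_mul K).tendsto 0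
    rw [mul_zero] at this
    exact this.mono_left nhdsWithin_le_nhds
  filter_upwards [self_mem_nhdsWithin, hlim.eventually_lt_const (sq_pos_of_pos hε)] with τ hτ hlt t ht
  rw [dist_comm, dist_eq_norm]
  exact lt_of_pow_lt_pow_left₀ 2 hε.le ((hx τ hτ t ht).trans_lt hlt)

/-- The limit of the regularized mean curves is absolutely continuous. -/
theorem ac_limit (hp : IsCoercivePair Q₀ H q h) (hR : IsRegularizer R) (hT : 0 ≤ T) {N : ℝ}
    (hm : ∀ τ > 0, IsYosidaMean R Q₀ H b τ T (m τ) (v τ))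
    (hN : ∀ τ > 0, ∀ t ∈ Icc 0 T, energy R H b τ (m τ 0) - energy R H b τ (m τ t) ≤ N)
    (hx : TendstoUniformlyOn m x (𝓝[>] 0) (Icc 0 T)) : AbsolutelyContinuousOnInterval x 0 T := by
  refine absolutelyContinuousOnInterval_of_tendsto (l := 𝓝[>] (0 : ℝ)) (f := m) (f' := v)
    (M := N / q) hT ?_ fun t ht => hx.tendsto_at ht
  filter_upwards [self_mem_nhdsWithin] with τ hτ
  have hτm := hm τ hτ
  refine ⟨hτm.deriv, hτm.cont, ?_⟩
  have hd := fun t (ht : t ∈ Icc 0 T) => hτm.hasDerivWithinAt_energy hR hτ hp ht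
  have hQv : ContinuousOn (fun t => -⟪precision Q₀ H t (v τ t), v τ t⟫_ℝ) (Icc 0 T) :=
    (((continuous_precision Q₀ H).continuousOn.clm_apply hτm.cont).inner hτm.cont).neg
  have hii : IntervalIntegrable (fun t => -⟪precision Q₀ H t (v τ t), v τ t⟫_ℝ) volume 0 T :=
    ContinuousOn.intervalIntegrable (by rwa [uIcc_of_le hT])
  have hftc : ∫ t in (0 : ℝ)..T, -⟪precision Q₀ H t (v τ t), v τ t⟫_ℝ =
      energy R H b τ (m τ T) - energy R H b τ (m τ 0) := by
    refine intervalIntegral.integral_eq_sub_of_hasDerivAt_of_le hT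
      (f := fun t => energy R H b τ (m τ t))
      (fun t ht => (hd t ht).continuousWithinAt) (fun t ht => ?_) hii
    exact (hd t (Ioo_subset_Icc_self ht)).hasDerivAt (Icc_mem_nhds ht.1 ht.2)
  -- Coercivity bounds `q‖v‖²` by the dissipation, whose integral is the energy drop.
  have hle : ∫ t in (0 : ℝ)..T, ‖v τ t‖ ^ 2 ≤
      ∫ t in (0 : ℝ)..T, (-1 / q) * -⟪precision Q₀ H t (v τ t), v τ t⟫_ℝ := by
    refine intervalIntegral.integral_mono_on hT
      (ContinuousOn.intervalIntegrable (by rw [uIcc_of_le hT]; exact hτm.cont.norm.pow 2))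
      (hii.const_mul _) fun t ht => ?_
    have := hp.coercive_precision ht.1 (v τ t)
    rw [div_mul_eq_mul_div, le_div_iff₀ hp.q_pos]
    linarith
  refine hle.trans ?_
  rw [intervalIntegral.integral_const_mul, hftc, div_mul_eq_mul_div]
  have := hN τ hτ T ⟨hT, le_rfl⟩
  have hq := hp.q_pos.le
  gcongr
  linarith

/-- Joint convergence of the resolvents along the regularized curves. -/
theorem tendsto_resolvent_limit {N : ℝ}
    (hN : ∀ τ > 0, ∀ t ∈ Icc 0 T, τ * ‖yosida R τ (m τ t)‖ ^ 2 ≤ N) {t : ℝ}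
    (hmx : Tendsto (fun p : ℝ × ℝ => m p.1 p.2) (𝓝[>] 0 ×ˢ 𝓝[Icc 0 T] t) (𝓝 (x t))) :
    Tendsto (fun p : ℝ × ℝ => resolvent R p.1 (m p.1 p.2)) (𝓝[>] 0 ×ˢ 𝓝[Icc 0 T] t)
      (𝓝 (x t)) := by
  have hev : ∀ᶠ p : ℝ × ℝ in 𝓝[>] 0 ×ˢ 𝓝[Icc 0 T] t, 0 < p.1 ∧ p.2 ∈ Icc 0 T :=
    Filter.prod_mem_prod self_mem_nhdsWithin self_mem_nhdsWithin
  have h0 : Tendsto (fun p : ℝ × ℝ => p.1 • yosida R p.1 (m p.1 p.2))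
      (𝓝[>] 0 ×ˢ 𝓝[Icc 0 T] t) (𝓝 0) := by
    refine squeeze_zero_norm' (a := fun p : ℝ × ℝ => √(N * p.1)) ?_ ?_
    · filter_upwards [hev] with p hp
      refine Real.le_sqrt_of_sq_le ?_
      rw [norm_smul, mul_pow, Real.norm_of_nonneg hp.1.le]
      have := mul_le_mul_of_nonneg_right (hN p.1 hp.1 p.2 hp.2) hp.1.le
      linarith
    · have h1 : Tendsto (fun p : ℝ × ℝ => p.1) (𝓝[>] 0 ×ˢ 𝓝[Icc 0 T] t) (𝓝 0) :=
        tendsto_fst.mono_right nhdsWithin_le_nhds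
      simpa using (h1.const_mul N).sqrt
  have h2 := hmx.sub h0
  rw [sub_zero] at h2
  refine h2.congr' ?_
  filter_upwards [hev] with p hp
  rw [resolvent_eq hp.1]

/-- Joint convergence in parameter and time provides bounds valid for all small `τ` on one common
time neighbourhood. -/
theorem tendsto_joint_limit (hx : TendstoUniformlyOn m x (𝓝[>] 0) (Icc 0 T))
    (hxc : ContinuousOn x (Icc 0 T)) {t : ℝ} (ht : t ∈ Icc 0 T) :
    Tendsto (fun p : ℝ × ℝ => m p.1 p.2) (𝓝[>] 0 ×ˢ 𝓝[Icc 0 T] t) (𝓝 (x t)) := by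
  rw [Metric.tendsto_nhds]
  intro ε hε
  have h1 := Metric.tendstoUniformlyOn_iff.1 hx (ε / 2) (half_pos hε)
  have h2 := Metric.tendsto_nhds.1 (hxc t ht) (ε / 2) (half_pos hε)
  have h3 : ∀ᶠ p : ℝ × ℝ in 𝓝[>] 0 ×ˢ 𝓝[Icc 0 T] t,
      (∀ s ∈ Icc 0 T, dist (x s) (m p.1 s) < ε / 2) ∧ dist (x p.2) (x t) < ε / 2 ∧
        p.2 ∈ Icc 0 T :=
    Filter.prod_mem_prod h1 (Filter.inter_mem h2 self_mem_nhdsWithin)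
  filter_upwards [h3] with p hp
  have h4 := hp.1 p.2 hp.2.2
  rw [dist_comm] at h4
  linarith [dist_triangle (m p.1 p.2) (x p.2) (x t), hp.2.1]

/-- At every point of differentiability the limit curve satisfies the differential inclusion. -/
theorem limit_mem_subdiff (hp : IsCoercivePair Q₀ H q h) (hR : IsRegularizer R) {N B : ℝ}
    (hm : ∀ τ > 0, IsYosidaMean R Q₀ H b τ T (m τ) (v τ))
    (hN : ∀ τ > 0, ∀ t ∈ Icc 0 T, τ * ‖yosida R τ (m τ t)‖ ^ 2 ≤ N ∧
      (R (resolvent R τ (m τ t))).toReal ≤ B)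
    (hx : TendstoUniformlyOn m x (𝓝[>] 0) (Icc 0 T)) (hxc : ContinuousOn x (Icc 0 T))
    {t : ℝ} (ht : t ∈ Ioo 0 T) {w : EuclideanSpace ℝ (Fin d)} (hw : HasDerivAt x w t) :
    b - H (x t) - precision Q₀ H t w ∈ subdiff R (x t) := by
  have htI := Ioo_subset_Icc_self ht
  have hmx := tendsto_joint_limit hx hxc htI
  have hJ := tendsto_resolvent_limit (fun τ hτ s hs => (hN τ hτ s hs).1) hmx
  have hev : ∀ᶠ p : ℝ × ℝ in 𝓝[>] 0 ×ˢ 𝓝[Icc 0 T] t, 0 < p.1 ∧ p.2 ∈ Icc 0 T :=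
    Filter.prod_mem_prod self_mem_nhdsWithin self_mem_nhdsWithin
  have : (𝓝[Icc 0 T] t).NeBot := mem_closure_iff_nhdsWithin_neBot.1 (subset_closure htI)
  -- Otherwise lower semicontinuity would push the values of `R` at the resolvents above their
  -- uniform bound `B`.
  have hfin : R (x t) ≠ ⊤ := by
    intro htop
    have h1 := hJ.eventually (hR.lsc (x t) (B : EReal) (by
      change (B : EReal) < R (x t)
      rw [htop]; exact EReal.coe_lt_top B))
    obtain ⟨p, hp1, hp2, hp3⟩ := (h1.and hev).exists
    rw [← hR.coe_toReal (hR.resolvent_ne_top hp2 _), gt_iff_lt, EReal.coe_lt_coe_iff] at hp1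
    exact absurd (hN p.1 hp2 p.2 hp3).2 (not_le.2 hp1)
  refine hR.mem_subdiff hfin fun z hz => ?_
  -- Collects the terms of the differentiated metric distance to `z` that depend continuously on the
  -- position alone.
  set g : EuclideanSpace ℝ (Fin d) → ℝ := fun y => ⟪b - H y, y - z⟫_ℝ + ⟪H (y - z), y - z⟫_ℝ
    with hg
  have hgc : Continuous g := by
    have := H.continuous
    rw [hg]; fun_prop
  have hmain : ∀ ε > 0, ⟪precision Q₀ H t w, x t - z⟫_ℝ + ⟪H (x t - z), x t - z⟫_ℝ ≤
      g (x t) + (R z).toReal - (R (x t)).toReal + 2 * ε := by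
    intro ε hε
    set c : ℝ := g (x t) + (R z).toReal - (R (x t)).toReal + 2 * ε with hc
    have h1 : ∀ᶠ p : ℝ × ℝ in 𝓝[>] 0 ×ˢ 𝓝[Icc 0 T] t,
        (R (x t)).toReal - ε < (R (resolvent R p.1 (m p.1 p.2))).toReal := by
      have hlt : (((R (x t)).toReal - ε : ℝ) : EReal) < R (x t) := by
        conv_rhs => rw [← hR.coe_toReal hfin]
        rw [EReal.coe_lt_coe_iff]; linarith
      filter_upwards [hJ.eventually (hR.lsc (x t) _ hlt), hev] with p hp1 hp2
      rwa [← hR.coe_toReal (hR.resolvent_ne_top hp2.1 _), gt_iff_lt, EReal.coe_lt_coe_iff] at hp1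
    have h2 : ∀ᶠ p : ℝ × ℝ in 𝓝[>] 0 ×ˢ 𝓝[Icc 0 T] t, g (m p.1 p.2) < g (x t) + ε :=
      ((hgc.tendsto (x t)).comp hmx).eventually_lt_const (by linarith)
    have h3 : ∀ᶠ p : ℝ × ℝ in 𝓝[>] 0 ×ˢ 𝓝[Icc 0 T] t, 0 < p.1 ∧
        2 * (⟪precision Q₀ H p.2 (v p.1 p.2), m p.1 p.2 - z⟫_ℝ +
          ⟪H (m p.1 p.2 - z), m p.1 p.2 - z⟫_ℝ) ≤ 2 * c := by
      filter_upwards [h1, h2, hev] with p hp1 hp2 hp3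
      refine ⟨hp3.1, ?_⟩
      have e : precision Q₀ H p.2 (v p.1 p.2) =
          (b - H (m p.1 p.2)) - yosida R p.1 (m p.1 p.2) := by
        rw [← (hm p.1 hp3.1).eq p.2 hp3.2]; abel
      have h4 := hR.toReal_resolvent_add_inner_le hp3.1 (m p.1 p.2) hz
      rw [← neg_sub, inner_neg_right] at h4
      simp only [hg] at hp2
      rw [e, inner_sub_left]
      linarith
    -- Splitting the joint neighbourhood yields a `δ` independent of `τ`. The derivative bound is
    -- used on `[t, s]` for fixed `τ`, then `τ ↓ 0`, and only afterwards `s ↓ t`.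
    obtain ⟨P, hP, S, hS, hPS⟩ := Filter.eventually_prod_iff.1 h3
    have hS' : ∀ᶠ s in 𝓝 t, S s := by
      rwa [nhdsWithin_eq_nhds.2 (Icc_mem_nhds ht.1 ht.2)] at hS
    obtain ⟨δ, hδ, hδS⟩ := Metric.eventually_nhds_iff.1
      (hS'.and (Ioo_mem_nhds ht.1 ht.2))
    set ψ : ℝ → ℝ := fun s => ⟪precision Q₀ H s (x s - z), x s - z⟫_ℝ with hψ
    have hψd : HasDerivAt ψ (2 * (⟪precision Q₀ H t w, x t - z⟫_ℝ +
        ⟪H (x t - z), x t - z⟫_ℝ)) t :=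
      (hp.hasDerivWithinAt_inner_precision (hw.sub_const z).hasDerivWithinAt).hasDerivAt univ_mem
    have hincr : ∀ s ∈ Ioo t (t + δ), ψ s - ψ t ≤ 2 * c * (s - t) := by
      intro s hs
      have hsub : ∀ r ∈ Icc t s, S r ∧ r ∈ Ioo 0 T := fun r hr => hδS (by
        rw [Real.dist_eq, abs_of_nonneg (by linarith [hr.1])]
        linarith [hr.2, hs.2])
      have hlim : ∀ r ∈ Icc t s, Tendsto (fun τ => ⟪precision Q₀ H r (m τ r - z), m τ r - z⟫_ℝ)
          (𝓝[>] 0) (𝓝 (ψ r)) := fun r hr => by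
        have h5 := (hx.tendsto_at (Ioo_subset_Icc_self (hsub r hr).2)).sub_const z
        exact (((precision Q₀ H r).continuous.tendsto _).comp h5).inner h5
      refine le_of_tendsto ((hlim s ⟨hs.1.le, le_rfl⟩).sub (hlim t ⟨le_rfl, hs.1.le⟩)) ?_
      filter_upwards [hP, self_mem_nhdsWithin] with τ hτ hτ0
      have hd : ∀ r ∈ Icc t s, HasDerivAt (fun r => ⟪precision Q₀ H r (m τ r - z), m τ r - z⟫_ℝ)
          (2 * (⟪precision Q₀ H r (v τ r), m τ r - z⟫_ℝ + ⟪H (m τ r - z), m τ r - z⟫_ℝ)) r :=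
        fun r hr => by
          have h6 := (hsub r hr).2
          have h7 := ((hm τ hτ0).deriv r (Ioo_subset_Icc_self h6)).hasDerivAt
            (Icc_mem_nhds h6.1 h6.2)
          exact (hp.hasDerivWithinAt_inner_precision
            (h7.sub_const z).hasDerivWithinAt).hasDerivAt univ_mem
      refine (convex_Icc t s).image_sub_le_mul_sub_of_deriv_le
        (fun r hr => (hd r hr).continuousAt.continuousWithinAt)
        (fun r hr => (hd r (interior_subset hr)).differentiableAt.differentiableWithinAt)
        (fun r hr => ?_) t ⟨le_rfl, hs.1.le⟩ s ⟨hs.1.le, le_rfl⟩ hs.1.le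
      rw [(hd r (interior_subset hr)).deriv]
      exact (hPS hτ (hsub r (interior_subset hr)).1).2
    have hslope := (hasDerivWithinAt_iff_tendsto_slope' (self_notMem_Ioi (a := t))).1
      (hψd.hasDerivWithinAt (s := Ioi t))
    have := le_of_tendsto hslope (b := 2 * c) (by
      filter_upwards [Ioo_mem_nhdsGT (show t < t + δ by linarith)] with s hs
      have h8 : 0 < s - t := sub_pos.2 hs.1
      rw [slope_def_field, div_le_iff₀ h8]
      exact hincr s hs)
    linarith
  have hfinal := le_of_forall_pos_le_add (a := ⟪precision Q₀ H t w, x t - z⟫_ℝ +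
    ⟪H (x t - z), x t - z⟫_ℝ) (b := g (x t) + (R z).toReal - (R (x t)).toReal) fun ε hε => by
      have := hmain (ε / 2) (half_pos hε)
      linarith
  simp only [hg] at hfinal
  rw [← neg_sub (x t) z, inner_neg_right, inner_sub_left]
  linarith

/-- The limit of the regularized mean dynamics solves the mean inclusion. -/
theorem IsCoercivePair.exists_mean_limit (hp : IsCoercivePair Q₀ H q h) (hR : IsRegularizer R)
    (hT : 0 < T) {m₀ : EuclideanSpace ℝ (Fin d)} (hm₀ : R m₀ ≠ ⊤)
    (hm : ∀ τ > 0, IsYosidaMean R Q₀ H b τ T (m τ) (v τ)) (h0 : ∀ τ > 0, m τ 0 = m₀) :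
    ∃ x : ℝ → EuclideanSpace ℝ (Fin d), x 0 = m₀ ∧
      TendstoUniformlyOn m x (𝓝[>] 0) (Icc 0 T) ∧ AbsolutelyContinuousOnInterval x 0 T ∧
      ∀ᵐ t ∂(volume.restrict (Icc (0 : ℝ) T)), ∃ w, ∃ ξ ∈ subdiff R (x t),
        HasDerivAt x w t ∧ precision Q₀ H t w + H (x t) + ξ = b := by
  obtain ⟨N, B, K₁, K₂, hN, hK₁, hK₂, hb⟩ := hp.exists_yosida_bounds hR hT.le hm₀ b
  have hb' := fun τ (hτ : τ > 0) => hb τ hτ (m τ) (v τ) (hm τ hτ) (h0 τ hτ)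
  obtain ⟨x, hx⟩ := exists_limit_of_norm_sub_sq_le (m := m) (s := Icc 0 T)
    (K := 2 * (K₁ * N + K₂ * T) / q) fun τ hτ σ hσ t ht =>
      hp.norm_yosidaMean_sub_sq_le hR hτ hσ hK₁ (hm τ hτ) (hm σ hσ)
        (fun s hs => ⟨(hb' τ hτ s hs).1, (hb' τ hτ s hs).2.2.2⟩)
        (fun s hs => ⟨(hb' σ hσ s hs).1, (hb' σ hσ s hs).2.2.2⟩) hK₂
        ((h0 τ hτ).trans (h0 σ hσ).symm) ht
  have hunif := tendstoUniformlyOn_of_norm_sub_sq_le hx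
  have hac := ac_limit hp hR hT.le hm (fun τ hτ t ht => (hb' τ hτ t ht).1) hunif
  have hxc : ContinuousOn x (Icc 0 T) := by
    have := hac.continuousOn
    rwa [uIcc_of_le hT.le] at this
  refine ⟨x, ?_, hunif, hac, ?_⟩
  · refine tendsto_nhds_unique (hunif.tendsto_at ⟨le_rfl, hT.le⟩)
      (tendsto_const_nhds.congr' ?_)
    filter_upwards [self_mem_nhdsWithin] with τ hτ using (h0 τ hτ).symm
  · have hIoo : ∀ᵐ t ∂(volume.restrict (Icc (0 : ℝ) T)), t ∈ Ioo 0 T :=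
      ae_restrict_Icc_of_forall_Ioo fun t ht => ht
    filter_upwards [hac.ae_restrict_differentiableAt hT.le, hIoo] with t hd ht
    refine ⟨deriv x t, _, limit_mem_subdiff hp hR hm (fun τ hτ s hs => ⟨(hb' τ hτ s hs).2.1,
      (hb' τ hτ s hs).2.2.1⟩) hunif hxc ht hd.hasDerivAt, hd.hasDerivAt, ?_⟩
    abel

end Limit

end SEKI

/-! ### Matrices and ensembles -/

namespace SEKI

section Matrices

variable {d : ℕ}

/-- A square matrix as an operator on Euclidean space. -/
noncomputable abbrev op (M : Matrix (Fin d) (Fin d) ℝ) :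
    EuclideanSpace ℝ (Fin d) →L[ℝ] EuclideanSpace ℝ (Fin d) :=
  Matrix.toEuclideanCLM (𝕜 := ℝ) M

theorem act_eq_op (M : Matrix (Fin d) (Fin d) ℝ) (v : EuclideanSpace ℝ (Fin d)) :
    act M v = op M v := rfl

theorem op_mul_apply (M N : Matrix (Fin d) (Fin d) ℝ) (v : EuclideanSpace ℝ (Fin d)) :
    op (M * N) v = op M (op N v) := by
  rw [op, map_mul]; rfl

theorem act_mul {l m n : ℕ} (M : Matrix (Fin l) (Fin m) ℝ) (N : Matrix (Fin m) (Fin n) ℝ)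
    (v : EuclideanSpace ℝ (Fin n)) : act (M * N) v = act M (act N v) := by
  simp [act, Matrix.mulVec_mulVec]

theorem act_sub {m n : ℕ} (M : Matrix (Fin m) (Fin n) ℝ) (u v : EuclideanSpace ℝ (Fin n)) :
    act M (u - v) = act M u - act M v := by
  simp [act, Matrix.mulVec_sub]

theorem inner_op_of_posDef {M : Matrix (Fin d) (Fin d) ℝ} (hM : M.PosDef)
    (u v : EuclideanSpace ℝ (Fin d)) : ⟪op M u, v⟫_ℝ = ⟪u, op M v⟫_ℝ := by
  have hs : Mᵀ = M := by simpa [Matrix.IsHermitian] using hM.isHermitian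
  rw [real_inner_comm, Matrix.inner_toEuclideanCLM, Matrix.inner_toEuclideanCLM,
    Matrix.dotProduct_mulVec, ← Matrix.mulVec_transpose, hs, dotProduct_comm]

theorem inner_op_pos {M : Matrix (Fin d) (Fin d) ℝ} (hM : M.PosDef)
    {v : EuclideanSpace ℝ (Fin d)} (hv : v ≠ 0) : 0 < ⟪op M v, v⟫_ℝ := by
  rw [real_inner_comm, Matrix.inner_toEuclideanCLM]
  have := hM.dotProduct_mulVec_pos (x := WithLp.ofLp v) (by simpa using hv)
  simpa using this

/-- The constant is the minimum of the quadratic form on the unit sphere; the sphere is empty only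
in dimension zero, where any constant works. -/
theorem exists_coercive_op {M : Matrix (Fin d) (Fin d) ℝ} (hM : M.PosDef) :
    ∃ q > 0, ∀ v, q * ‖v‖ ^ 2 ≤ ⟪op M v, v⟫_ℝ := by
  have hc : Continuous fun v : EuclideanSpace ℝ (Fin d) => ⟪op M v, v⟫_ℝ := by fun_prop
  rcases (Metric.sphere (0 : EuclideanSpace ℝ (Fin d)) 1).eq_empty_or_nonempty with he | hne
  · refine ⟨1, one_pos, fun v => ?_⟩
    have hv : v = 0 := by
      by_contra hv
      have : ‖v‖⁻¹ • v ∈ Metric.sphere (0 : EuclideanSpace ℝ (Fin d)) 1 := by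
        simp [norm_smul, norm_ne_zero_iff.2 hv]
      rw [he] at this
      exact this
    simp [hv]
  · obtain ⟨u, hu, hmin⟩ := (isCompact_sphere (0 : EuclideanSpace ℝ (Fin d)) 1).exists_isMinOn hne
      hc.continuousOn
    have hu1 : ‖u‖ = 1 := by simpa using hu
    refine ⟨⟪op M u, u⟫_ℝ, inner_op_pos hM (norm_ne_zero_iff.1 (by rw [hu1]; exact one_ne_zero)),
      fun v => ?_⟩
    by_cases hv : v = 0
    · simp [hv]
    have hv0 : ‖v‖ ≠ 0 := norm_ne_zero_iff.2 hv
    have hle : ⟪op M u, u⟫_ℝ ≤ ⟪op M (‖v‖⁻¹ • v), ‖v‖⁻¹ • v⟫_ℝ :=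
      hmin (show ‖v‖⁻¹ • v ∈ Metric.sphere (0 : EuclideanSpace ℝ (Fin d)) 1 by
        simp [norm_smul, hv0])
    rw [map_smul, real_inner_smul_left, real_inner_smul_right] at hle
    calc ⟪op M u, u⟫_ℝ * ‖v‖ ^ 2 ≤ ‖v‖⁻¹ * (‖v‖⁻¹ * ⟪op M v, v⟫_ℝ) * ‖v‖ ^ 2 := by gcongr
      _ = ⟪op M v, v⟫_ℝ := by field_simp

theorem wnorm_eq_of_mul_eq_one {C Q : Matrix (Fin d) (Fin d) ℝ} (h : C * Q = 1)
    (v : EuclideanSpace ℝ (Fin d)) : wnorm C v = √⟪op Q v, v⟫_ℝ := by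
  rw [wnorm, Matrix.inv_eq_right_inv h, real_inner_comm, Matrix.inner_toEuclideanCLM]

theorem continuousOn_inverse_of_isUnit {E : Type*} [NormedAddCommGroup E] [NormedSpace ℝ E]
    [CompleteSpace E] {f : ℝ → E →L[ℝ] E} {s : Set ℝ} (hf : ContinuousOn f s)
    (hu : ∀ t ∈ s, IsUnit (f t)) : ContinuousOn (fun t => Ring.inverse (f t)) s := by
  intro t ht
  obtain ⟨u, hu⟩ := hu t ht
  have h := NormedRing.inverse_continuousAt u
  rw [hu] at h
  exact h.comp_continuousWithinAt (hf t ht)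

end Matrices

/-! ### Means, deviations and covariances of ensembles -/

section Ensembles

variable {d J : ℕ}

theorem op_cov (x : Fin J → EuclideanSpace ℝ (Fin d)) :
    op (cov x) = covOp (1 / (J : ℝ)) (dev x) := by
  ext1 v
  rw [covOp_apply, cov, op, map_smul, map_sum, smul_apply, sum_apply]
  refine congrArg _ (Finset.sum_congr rfl fun j _ => ?_)
  ext i
  rw [Matrix.ofLp_toEuclideanCLM, Matrix.vecMulVec_mulVec]
  simp [PiLp.inner_apply, dotProduct, mul_comm]

theorem mean_add_dev (x : Fin J → EuclideanSpace ℝ (Fin d)) (j : Fin J) :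
    mean x + dev x j = x j := by
  rw [dev]; abel

theorem sum_dev (x : Fin J → EuclideanSpace ℝ (Fin d)) : ∑ j, dev x j = 0 := by
  rcases Nat.eq_zero_or_pos J with rfl | hJ
  · simp
  · have : (J : ℝ) ≠ 0 := by positivity
    simp only [dev, mean, Finset.sum_sub_distrib, Finset.sum_const, Finset.card_univ,
      Fintype.card_fin, ← Nat.cast_smul_eq_nsmul ℝ, smul_smul]
    rw [mul_one_div_cancel this, one_smul, sub_self]

/-- An ensemble with invertible covariance is nonempty, except in dimension zero. -/
theorem ne_zero_or_eq_zero_of_posDef {x : Fin J → EuclideanSpace ℝ (Fin d)}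
    (hx : (cov x).PosDef) : J ≠ 0 ∨ d = 0 := by
  by_contra! h
  obtain ⟨rfl, hd⟩ := h
  have h0 : cov x = 0 := by simp [cov]
  have := hx.diag_pos (i := ⟨0, Nat.pos_of_ne_zero hd⟩)
  simp [h0] at this

/-- With no particles `1 / (J : ℝ)` is `0` and the mean is `0`, which is correct only in the trivial
space; hence the disjunction. -/
theorem mean_const_add (hJ : J ≠ 0 ∨ d = 0) (m : EuclideanSpace ℝ (Fin d))
    {e : Fin J → EuclideanSpace ℝ (Fin d)} (he : ∑ j, e j = 0) : mean (fun j => m + e j) = m := by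
  rcases hJ with hJ | rfl
  · have : (J : ℝ) ≠ 0 := by exact_mod_cast hJ
    rw [mean, Finset.sum_add_distrib, he, add_zero, Finset.sum_const, Finset.card_univ,
      Fintype.card_fin, ← Nat.cast_smul_eq_nsmul ℝ, smul_smul, one_div_mul_cancel this, one_smul]
  · exact Subsingleton.elim _ _

theorem dev_const_add (hJ : J ≠ 0 ∨ d = 0) (m : EuclideanSpace ℝ (Fin d))
    {e : Fin J → EuclideanSpace ℝ (Fin d)} (he : ∑ j, e j = 0) (j : Fin J) :
    dev (fun j => m + e j) j = e j := by
  rw [dev, mean_const_add hJ m he]; abel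

theorem ac_mean {x : ℝ → Fin J → EuclideanSpace ℝ (Fin d)} {T : ℝ}
    (hx : AbsolutelyContinuousOnInterval x 0 T) :
    AbsolutelyContinuousOnInterval (fun t => mean (x t)) 0 T := by
  unfold mean
  exact (AbsolutelyContinuousOnInterval.finset_sum Finset.univ fun j _ =>
    hx.lipschitz_comp (LipschitzWith.eval j)).const_smul _

theorem ac_dev {x : ℝ → Fin J → EuclideanSpace ℝ (Fin d)} {T : ℝ}
    (hx : AbsolutelyContinuousOnInterval x 0 T) (j : Fin J) :
    AbsolutelyContinuousOnInterval (fun t => dev (x t) j) 0 T :=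
  (hx.lipschitz_comp (LipschitzWith.eval j)).fun_sub (ac_mean hx)

end Ensembles

/-! ### Reduction of both systems to precision form -/

section Flow

variable {d K J : ℕ} {A : Matrix (Fin K) (Fin d) ℝ} {Γ : Matrix (Fin K) (Fin K) ℝ}
  {C₀ : Matrix (Fin d) (Fin d) ℝ} {y : EuclideanSpace ℝ (Fin K)}
  {R : EuclideanSpace ℝ (Fin d) → EReal} {τ T : ℝ}

/-- The Hessian `Aᵀ Γ⁻¹ A + C₀⁻¹` of the smooth part of the functional. -/
noncomputable def hessian (A : Matrix (Fin K) (Fin d) ℝ) (Γ : Matrix (Fin K) (Fin K) ℝ)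
    (C₀ : Matrix (Fin d) (Fin d) ℝ) : Matrix (Fin d) (Fin d) ℝ :=
  Aᵀ * Γ⁻¹ * A + C₀⁻¹

/-- The matrix `P⁻¹ + 2 t H`. -/
noncomputable def precisionMatrix (P M : Matrix (Fin d) (Fin d) ℝ) (t : ℝ) :
    Matrix (Fin d) (Fin d) ℝ :=
  P⁻¹ + (2 * t) • M

theorem posDef_hessian (A : Matrix (Fin K) (Fin d) ℝ) (hΓ : Γ.PosDef) (hC₀ : C₀.PosDef) :
    (hessian A Γ C₀).PosDef := by
  have h := hΓ.inv.posSemidef.conjTranspose_mul_mul_same A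
  rw [Matrix.conjTranspose_eq_transpose_of_trivial] at h
  exact hC₀.inv.posSemidef_add h

theorem op_precisionMatrix (P M : Matrix (Fin d) (Fin d) ℝ) (t : ℝ) :
    op (precisionMatrix P M t) = precision (op P⁻¹) (op M) t := by
  rw [precisionMatrix, precision, op, map_add, map_smul]

theorem posDef_precisionMatrix {P M : Matrix (Fin d) (Fin d) ℝ} (hP : P.PosDef) (hM : M.PosDef)
    {t : ℝ} (ht : 0 ≤ t) : (precisionMatrix P M t).PosDef :=
  hP.inv.add_posSemidef (hM.posSemidef.smul (by positivity))

theorem isUnit_precision {P M : Matrix (Fin d) (Fin d) ℝ} (hP : P.PosDef) (hM : M.PosDef)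
    {t : ℝ} (ht : 0 ≤ t) : IsUnit (precision (op P⁻¹) (op M) t) := by
  rw [← op_precisionMatrix]
  exact (posDef_precisionMatrix hP hM ht).isUnit.map _

theorem exists_isCoercivePair {P M : Matrix (Fin d) (Fin d) ℝ} (hP : P.PosDef) (hM : M.PosDef) :
    ∃ q h, IsCoercivePair (op P⁻¹) (op M) q h := by
  obtain ⟨q, hq, hq'⟩ := exists_coercive_op hP.inv
  obtain ⟨h, hh, hh'⟩ := exists_coercive_op hM
  exact ⟨q, h, hq, hh, inner_op_of_posDef hP.inv, inner_op_of_posDef hM, hq', hh'⟩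

theorem devField_eq (x : Fin J → EuclideanSpace ℝ (Fin d)) (j : Fin J) :
    devField A Γ C₀ x j = -(op (cov x) (op (hessian A Γ C₀) (dev x j))) := by
  rw [devField, act_eq_op, op_mul_apply, hessian]

/-- Factoring out the covariance leaves `Hm - b`, so that applying the precision can cancel it. -/
theorem meanDrift_eq (x : Fin J → EuclideanSpace ℝ (Fin d)) :
    meanDrift A Γ C₀ y x =
      op (cov x) (op (hessian A Γ C₀) (mean x) - act (Aᵀ * Γ⁻¹) y) := by
  have h : op (hessian A Γ C₀) (mean x) =
      act (Aᵀ * Γ⁻¹ * A) (mean x) + act C₀⁻¹ (mean x) := by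
    rw [hessian, op, map_add]; rfl
  rw [h, meanDrift, Matrix.mul_assoc, act_mul, act_sub, act_mul (cov x) C₀⁻¹,
    act_mul (Aᵀ * Γ⁻¹) A, act_eq_op (cov x), act_eq_op (cov x), ← map_add]
  congr 1
  abel

/-- The deviations of an absolutely continuous curve of ensembles determine its covariance. -/
theorem cov_mul_precisionMatrix {P : Matrix (Fin d) (Fin d) ℝ} (hP : P.PosDef)
    (hM : (hessian A Γ C₀).PosDef) {z : ℝ → Fin J → EuclideanSpace ℝ (Fin d)}
    (hz0 : cov (z 0) = P)
    (hac : ∀ j, AbsolutelyContinuousOnInterval (fun t => dev (z t) j) 0 T)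
    (hd : ∀ᵐ t ∂(volume.restrict (Icc (0 : ℝ) T)),
      ∀ j, HasDerivAt (fun s => dev (z s) j) (devField A Γ C₀ (z t) j) t)
    {t : ℝ} (ht : t ∈ Icc 0 T) : cov (z t) * precisionMatrix P (hessian A Γ C₀) t = 1 := by
  have h := covOp_precision_of_ac (r := 1 / (J : ℝ)) (Q₀ := op P⁻¹) (H := op (hessian A Γ C₀))
    (e := fun j t => dev (z t) j) (T := T) (inner_op_of_posDef hM) hac
    (by
      filter_upwards [hd] with s hs j
      rw [← op_cov, ← devField_eq]
      exact hs j)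
    (fun v => by
      have : P * P⁻¹ = 1 := Matrix.mul_nonsing_inv _ ((Matrix.isUnit_iff_isUnit_det P).1 hP.isUnit)
      rw [← op_cov, hz0, ← op_mul_apply, this, op, map_one]; rfl) ht
  refine (Matrix.toEuclideanCLM (𝕜 := ℝ) (n := Fin d)).injective ?_
  rw [map_one]
  ext1 v
  change op _ v = v
  rw [op_mul_apply, op_precisionMatrix, op_cov]
  exact h v

/-- The covariance operator `(P⁻¹ + 2 t H)⁻¹`. -/
noncomputable def covFlow (P M : Matrix (Fin d) (Fin d) ℝ) (t : ℝ) :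
    EuclideanSpace ℝ (Fin d) →L[ℝ] EuclideanSpace ℝ (Fin d) :=
  Ring.inverse (precision (op P⁻¹) (op M) t)

section covFlow

variable {P M : Matrix (Fin d) (Fin d) ℝ} (hP : P.PosDef) (hM : M.PosDef)
include hP hM

theorem covFlow_precision {t : ℝ} (ht : 0 ≤ t) (v : EuclideanSpace ℝ (Fin d)) :
    covFlow P M t (precision (op P⁻¹) (op M) t v) = v :=
  congrArg (fun L => L v) (Ring.inverse_mul_cancel _ (isUnit_precision hP hM ht))

theorem precision_covFlow {t : ℝ} (ht : 0 ≤ t) (v : EuclideanSpace ℝ (Fin d)) :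
    precision (op P⁻¹) (op M) t (covFlow P M t v) = v :=
  congrArg (fun L => L v) (Ring.mul_inverse_cancel _ (isUnit_precision hP hM ht))

theorem continuousOn_covFlow : ContinuousOn (covFlow P M) (Icc 0 T) :=
  continuousOn_inverse_of_isUnit (continuous_precision _ _).continuousOn
    fun _ ht => isUnit_precision hP hM ht.1

theorem op_eq_covFlow {C : Matrix (Fin d) (Fin d) ℝ} {t : ℝ} (ht : 0 ≤ t)
    (h : C * precisionMatrix P M t = 1) : op C = covFlow P M t := by
  ext1 v
  conv_lhs => rw [← precision_covFlow hP hM ht v]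
  rw [← op_precisionMatrix, ← op_mul_apply, h, op, map_one]
  rfl

end covFlow

/-- The facts on the mean and the deviations that are shared by all solutions. -/
structure IsReduced (P M : Matrix (Fin d) (Fin d) ℝ) (b : EuclideanSpace ℝ (Fin d)) (T : ℝ)
    (G : EuclideanSpace ℝ (Fin d) → Set (EuclideanSpace ℝ (Fin d)))
    (z : ℝ → Fin J → EuclideanSpace ℝ (Fin d)) : Prop where
  cov_mul : ∀ t ∈ Icc 0 T, cov (z t) * precisionMatrix P M t = 1
  ac_dev : ∀ j, AbsolutelyContinuousOnInterval (fun t => dev (z t) j) 0 T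
  ac_mean : AbsolutelyContinuousOnInterval (fun t => mean (z t)) 0 T
  deriv_dev : ∀ᵐ t ∂(volume.restrict (Icc (0 : ℝ) T)), ∀ j,
    HasDerivAt (fun s => dev (z s) j) (-(covFlow P M t (op M (dev (z t) j)))) t
  deriv_mean : ∀ᵐ t ∂(volume.restrict (Icc (0 : ℝ) T)), ∃ v, ∃ ξ ∈ G (mean (z t)),
    HasDerivAt (fun s => mean (z s)) v t ∧
      precision (op P⁻¹) (op M) t v + op M (mean (z t)) + ξ = b

section Reduced

variable {P : Matrix (Fin d) (Fin d) ℝ} (hP : P.PosDef) (hΓ : Γ.PosDef) (hC₀ : C₀.PosDef)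
include hP hΓ hC₀

/-- The covariance is now explicit and invertible; applying `Q(t)` strips it from the inclusion. -/
theorem IsSolution.isReduced {z₀ : Fin J → EuclideanSpace ℝ (Fin d)}
    {z : ℝ → Fin J → EuclideanSpace ℝ (Fin d)} (hz : IsSolution A Γ C₀ y R T z₀ z)
    (hz₀ : cov z₀ = P) :
    IsReduced P (hessian A Γ C₀) (act (Aᵀ * Γ⁻¹) y) T (subdiff R) z := by
  have hM := posDef_hessian A hΓ hC₀
  have hcov := fun t (ht : t ∈ Icc 0 T) => cov_mul_precisionMatrix hP hM (by rw [hz.init, hz₀])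
    (ac_dev hz.absCont) hz.dev_eq ht
  refine ⟨hcov, ac_dev hz.absCont, ac_mean hz.absCont, ?_, ?_⟩
  · filter_upwards [hz.dev_eq, ae_restrict_mem measurableSet_Icc] with t ht htI j
    have := ht j
    rwa [devField_eq, op_eq_covFlow hP hM htI.1 (hcov t htI)] at this
  · filter_upwards [hz.mean_inclusion, ae_restrict_mem measurableSet_Icc] with t ht htI
    obtain ⟨v, hv, ξ, hξ, he⟩ := ht
    refine ⟨v, ξ, hξ, hv, ?_⟩
    simp only [act_eq_op, meanDrift_eq, op_eq_covFlow hP hM htI.1 (hcov t htI)] at he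
    have h2 := congrArg (precision (op P⁻¹) (op (hessian A Γ C₀)) t) he
    rw [map_add, map_neg, precision_covFlow hP hM htI.1, precision_covFlow hP hM htI.1] at h2
    rw [eq_comm, ← sub_eq_zero] at h2
    rw [← sub_eq_zero, ← h2]
    abel

/-- A classical solution has continuous, hence bounded, velocity on `[0,T]`, so it is absolutely
continuous and the same covariance argument applies. -/
theorem IsYosidaSolution.isReduced (hR : IsRegularizer R) (hτ : 0 < τ) (hT : 0 ≤ T)
    {z₀ : Fin J → EuclideanSpace ℝ (Fin d)}
    {z : ℝ → Fin J → EuclideanSpace ℝ (Fin d)} (hz : IsYosidaSolution A Γ C₀ y R τ T z₀ z)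
    (hz₀ : cov z₀ = P) :
    IsReduced P (hessian A Γ C₀) (act (Aᵀ * Γ⁻¹) y) T (fun x => {yosida R τ x}) z := by
  have hM := posDef_hessian A hΓ hC₀
  have hdevc : ∀ j, ContinuousOn (fun t => dev (z t) j) (Icc 0 T) := fun j t ht =>
    (hz.dev_eq t ht j).continuousWithinAt
  have hmeanc : ContinuousOn (fun t => mean (z t)) (Icc 0 T) := fun t ht =>
    (hz.mean_eq t ht).continuousWithinAt
  have hcovc : ContinuousOn (fun t => op (cov (z t))) (Icc 0 T) := by
    simp only [op_cov]
    exact continuousOn_covOp _ hdevc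
  have hacd : ∀ j, AbsolutelyContinuousOnInterval (fun t => dev (z t) j) 0 T := fun j => by
    have hc : ContinuousOn (fun t => devField A Γ C₀ (z t) j) (Icc 0 T) := by
      simp only [devField_eq]
      exact (hcovc.clm_apply ((op (hessian A Γ C₀)).continuous.comp_continuousOn (hdevc j))).neg
    obtain ⟨L, hL⟩ := isCompact_Icc.exists_bound_of_continuousOn hc
    exact absolutelyContinuousOnInterval_of_hasDerivWithinAt hT (fun t ht => hz.dev_eq t ht j) hL
  have hacm : AbsolutelyContinuousOnInterval (fun t => mean (z t)) 0 T := by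
    have hc : ContinuousOn (fun t => -meanDrift A Γ C₀ y (z t) -
        act (cov (z t)) (yosida R τ (mean (z t)))) (Icc 0 T) := by
      simp only [meanDrift_eq, act_eq_op]
      exact (hcovc.clm_apply (((op (hessian A Γ C₀)).continuous.comp_continuousOn hmeanc).sub
        continuousOn_const)).neg.sub (hcovc.clm_apply
          ((hR.lipschitzWith_yosida hτ).continuous.comp_continuousOn hmeanc))
    obtain ⟨L, hL⟩ := isCompact_Icc.exists_bound_of_continuousOn hc
    exact absolutelyContinuousOnInterval_of_hasDerivWithinAt hT hz.mean_eq hL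
  have hd : ∀ᵐ t ∂(volume.restrict (Icc (0 : ℝ) T)),
      ∀ j, HasDerivAt (fun s => dev (z s) j) (devField A Γ C₀ (z t) j) t :=
    ae_restrict_Icc_of_forall_Ioo fun t ht j =>
      (hz.dev_eq t (Ioo_subset_Icc_self ht) j).hasDerivAt (Icc_mem_nhds ht.1 ht.2)
  have hcov := fun t (ht : t ∈ Icc 0 T) => cov_mul_precisionMatrix hP hM (by rw [hz.init, hz₀])
    hacd hd ht
  refine ⟨hcov, hacd, hacm, ?_, ?_⟩
  · filter_upwards [hd, ae_restrict_mem measurableSet_Icc] with t ht htI j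
    have := ht j
    rwa [devField_eq, op_eq_covFlow hP hM htI.1 (hcov t htI)] at this
  · refine ae_restrict_Icc_of_forall_Ioo fun t ht => ?_
    have htI := Ioo_subset_Icc_self ht
    refine ⟨_, _, rfl, (hz.mean_eq t htI).hasDerivAt (Icc_mem_nhds ht.1 ht.2), ?_⟩
    rw [meanDrift_eq, act_eq_op (cov _), op_eq_covFlow hP hM htI.1 (hcov t htI), map_sub, map_neg,
      precision_covFlow hP hM htI.1, precision_covFlow hP hM htI.1]
    abel

end Reduced

namespace IsReduced

variable {P M : Matrix (Fin d) (Fin d) ℝ} {b : EuclideanSpace ℝ (Fin d)}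
  {G : EuclideanSpace ℝ (Fin d) → Set (EuclideanSpace ℝ (Fin d))}
  {z w : ℝ → Fin J → EuclideanSpace ℝ (Fin d)}

theorem cov_eq (hz : IsReduced P M b T G z) {t : ℝ} (ht : t ∈ Icc 0 T) :
    cov (z t) = (precisionMatrix P M t)⁻¹ :=
  (Matrix.inv_eq_left_inv (hz.cov_mul t ht)).symm

theorem contraction (hP : P.PosDef) (hM : M.PosDef)
    (hG : ∀ x y ξ η, ξ ∈ G x → η ∈ G y → 0 ≤ ⟪ξ - η, x - y⟫_ℝ)
    (hz : IsReduced P M b T G z) (hw : IsReduced P M b T G w) {t : ℝ} (ht : t ∈ Icc 0 T) :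
    ⟪precision (op P⁻¹) (op M) t (mean (z t) - mean (w t)), mean (z t) - mean (w t)⟫_ℝ ≤
      ⟪op P⁻¹ (mean (z 0) - mean (w 0)), mean (z 0) - mean (w 0)⟫_ℝ := by
  obtain ⟨q, h, hp⟩ := exists_isCoercivePair hP hM
  refine hp.contraction (m := fun t => mean (z t)) (n := fun t => mean (w t)) (b := b)
    hz.ac_mean hw.ac_mean ?_ ht
  filter_upwards [hz.deriv_mean, hw.deriv_mean] with s h1 h2
  obtain ⟨v, ξ, hξ, hv, e1⟩ := h1
  obtain ⟨v', η, hη, hv', e2⟩ := h2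
  exact ⟨v, v', ξ, η, hv, hv', e1, e2, hG _ _ _ _ hξ hη⟩

/-- The contraction identifies the means. The deviations then solve one linear equation, since both
ensembles have the coefficient `covFlow`. -/
theorem eqOn (hP : P.PosDef) (hM : M.PosDef)
    (hG : ∀ x y ξ η, ξ ∈ G x → η ∈ G y → 0 ≤ ⟪ξ - η, x - y⟫_ℝ)
    (hz : IsReduced P M b T G z) (hw : IsReduced P M b T G w) (h0 : z 0 = w 0) :
    EqOn z w (Icc 0 T) := by
  intro t ht
  obtain ⟨q, h, hp⟩ := exists_isCoercivePair hP hM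
  obtain ⟨L, hL⟩ := isCompact_Icc.exists_bound_of_continuousOn
    (continuousOn_covFlow (T := T) hP hM)
  have hmean : mean (z t) = mean (w t) := by
    have h1 := contraction hP hM hG hz hw ht
    have h2 := hp.coercive_precision ht.1 (mean (z t) - mean (w t))
    rw [h0, sub_self, map_zero, inner_zero_left] at h1
    have h3 : ‖mean (z t) - mean (w t)‖ ^ 2 ≤ 0 := by
      by_contra! h4
      have := mul_pos hp.q_pos h4
      linarith
    exact sub_eq_zero.1 (norm_eq_zero.1 (pow_eq_zero_iff two_ne_zero |>.1
      (le_antisymm h3 (sq_nonneg _))))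
  ext1 j
  have hdev : dev (z t) j = dev (w t) j :=
    eqOn_of_linear_ac (hz.ac_dev j) (hw.ac_dev j) hL (hz.deriv_dev.mono fun s hs => hs j)
      (hw.deriv_dev.mono fun s hs => hs j) (by simp only [h0]) ht
  rw [← mean_add_dev (z t), ← mean_add_dev (w t), hmean, hdev]

end IsReduced

end Flow

end SEKI

/-! ### Reconstruction of ensembles from a mean curve and deviations -/

namespace SEKI

section Existence

variable {d K J : ℕ} {A : Matrix (Fin K) (Fin d) ℝ} {Γ : Matrix (Fin K) (Fin K) ℝ}
  {C₀ : Matrix (Fin d) (Fin d) ℝ} {y : EuclideanSpace ℝ (Fin K)}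
  {R : EuclideanSpace ℝ (Fin d) → EReal} {τ T : ℝ} {x₀ : Fin J → EuclideanSpace ℝ (Fin d)}

/-- Existence of centred deviations whose covariance is `covFlow`. -/
theorem exists_centred_deviations {M : Matrix (Fin d) (Fin d) ℝ} (hx₀ : (cov x₀).PosDef)
    (hM : M.PosDef) (hT : 0 < T) :
    ∃ e : ℝ → Fin J → EuclideanSpace ℝ (Fin d), e 0 = dev x₀ ∧ (∀ t, ∑ j, e t j = 0) ∧
      (∀ j, ∀ t ∈ Icc 0 T, HasDerivWithinAt (fun t => e t j)
        (-(covFlow (cov x₀) M t (op M (e t j)))) (Icc 0 T) t) ∧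
      ∀ t ∈ Icc 0 T, covOp (1 / (J : ℝ)) (e t) = covFlow (cov x₀) M t := by
  obtain ⟨Φ, hΦ0, hΦ, hcov⟩ := exists_deviations (r := 1 / (J : ℝ)) hT (inner_op_of_posDef hM)
    (inner_op_of_posDef hx₀.inv) (continuousOn_covFlow hx₀ hM)
    (fun t ht => covFlow_precision hx₀ hM ht.1) (fun t ht => precision_covFlow hx₀ hM ht.1)
    (dev x₀) (fun v => by
      have : cov x₀ * (cov x₀)⁻¹ = 1 :=
        Matrix.mul_nonsing_inv _ ((Matrix.isUnit_iff_isUnit_det _).1 hx₀.isUnit)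
      rw [← op_cov, ← op_mul_apply, this, op, map_one]; rfl)
  refine ⟨fun t j => Φ t (dev x₀ j), by simp [hΦ0], fun t => ?_, fun j => hΦ _, hcov⟩
  -- Linearity of the common flow map preserves the zero sum of the initial deviations.
  rw [← map_sum, sum_dev, map_zero]

variable {e : ℝ → Fin J → EuclideanSpace ℝ (Fin d)} (hJ : J ≠ 0 ∨ d = 0)
  (he0 : e 0 = dev x₀) (hsum : ∀ t, ∑ j, e t j = 0)
  (hde : ∀ j, ∀ t ∈ Icc 0 T, HasDerivWithinAt (fun t => e t j)
    (-(covFlow (cov x₀) (hessian A Γ C₀) t (op (hessian A Γ C₀) (e t j)))) (Icc 0 T) t)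
  (hcov : ∀ t ∈ Icc 0 T, covOp (1 / (J : ℝ)) (e t) = covFlow (cov x₀) (hessian A Γ C₀) t)

section
include hJ hsum

theorem dev_mean_add (m : ℝ → EuclideanSpace ℝ (Fin d)) (t : ℝ) :
    dev (fun j => m t + e t j) = e t :=
  funext fun j => dev_const_add hJ _ (hsum t) j

include hcov

theorem op_cov_mean_add (m : ℝ → EuclideanSpace ℝ (Fin d)) {t : ℝ} (ht : t ∈ Icc 0 T) :
    op (cov fun j => m t + e t j) = covFlow (cov x₀) (hessian A Γ C₀) t := by
  rw [op_cov, dev_mean_add hJ hsum, hcov t ht]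

include hde

theorem hasDerivWithinAt_dev_mean_add (m : ℝ → EuclideanSpace ℝ (Fin d)) {t : ℝ}
    (ht : t ∈ Icc 0 T) (j : Fin J) :
    HasDerivWithinAt (fun s => dev (fun j => m s + e s j) j)
      (devField A Γ C₀ (fun j => m t + e t j) j) (Icc 0 T) t := by
  rw [devField_eq, op_cov_mean_add hJ hsum hcov m ht]
  simp only [dev_mean_add hJ hsum]
  exact hde j t ht

end

include hJ he0 hsum hde hcov

theorem isYosidaSolution_mean_add {m : ℝ → EuclideanSpace ℝ (Fin d)} (hm0 : m 0 = mean x₀)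
    (hm : IsYosidaMean R (op (cov x₀)⁻¹) (op (hessian A Γ C₀)) (act (Aᵀ * Γ⁻¹) y) τ T m
      fun t => covFlow (cov x₀) (hessian A Γ C₀) t
        (act (Aᵀ * Γ⁻¹) y - op (hessian A Γ C₀) (m t) - yosida R τ (m t))) :
    IsYosidaSolution A Γ C₀ y R τ T x₀ fun t j => m t + e t j where
  init := funext fun j => by rw [hm0, he0, mean_add_dev]
  mean_eq t ht := by
    have h1 : ∀ s, mean (fun j => m s + e s j) = m s := fun s => mean_const_add hJ _ (hsum s)
    rw [meanDrift_eq, act_eq_op (cov _), op_cov_mean_add hJ hsum hcov m ht]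
    simp only [h1]
    refine (hm.deriv t ht).congr_deriv ?_
    simp only [map_sub]
    abel
  dev_eq t ht j := hasDerivWithinAt_dev_mean_add hJ hsum hde hcov m ht j

/-- Applying `covFlow` to the precision form restores the covariance in front of the subgradient; it
really is the covariance of the assembled ensemble because the deviations are centred. -/
theorem isSolution_mean_add (hx₀ : (cov x₀).PosDef) (hM : (hessian A Γ C₀).PosDef) (hT : 0 ≤ T)
    {m : ℝ → EuclideanSpace ℝ (Fin d)} (hm0 : m 0 = mean x₀)
    (hac : AbsolutelyContinuousOnInterval m 0 T)
    (hm : ∀ᵐ t ∂(volume.restrict (Icc (0 : ℝ) T)), ∃ w, ∃ ξ ∈ subdiff R (m t),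
      HasDerivAt m w t ∧ precision (op (cov x₀)⁻¹) (op (hessian A Γ C₀)) t w +
        op (hessian A Γ C₀) (m t) + ξ = act (Aᵀ * Γ⁻¹) y) :
    IsSolution A Γ C₀ y R T x₀ fun t j => m t + e t j where
  init := funext fun j => by rw [hm0, he0, mean_add_dev]
  absCont := by
    refine AbsolutelyContinuousOnInterval.pi fun j => hac.fun_add ?_
    have hec : ContinuousOn (fun t => e t j) (Icc 0 T) := fun t ht =>
      (hde j t ht).continuousWithinAt
    obtain ⟨L, hL⟩ := isCompact_Icc.exists_bound_of_continuousOn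
      (((continuousOn_covFlow hx₀ hM).clm_apply
        ((op (hessian A Γ C₀)).continuous.comp_continuousOn hec)).neg)
    exact absolutelyContinuousOnInterval_of_hasDerivWithinAt hT (hde j) hL
  mean_inclusion := by
    have h1 : ∀ s, mean (fun j => m s + e s j) = m s := fun s => mean_const_add hJ _ (hsum s)
    filter_upwards [hm, ae_restrict_mem measurableSet_Icc] with t ht htI
    obtain ⟨w, ξ, hξ, hw, heq⟩ := ht
    simp only [meanDrift_eq, act_eq_op (cov _), op_cov_mean_add hJ hsum hcov m htI, h1]
    refine ⟨w, hw, ξ, hξ, ?_⟩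
    have h2 := congrArg (covFlow (cov x₀) (hessian A Γ C₀) t) heq
    rw [map_add, map_add, covFlow_precision hx₀ hM htI.1] at h2
    simp only [map_sub]
    rw [← h2]
    abel
  dev_eq := ae_restrict_Icc_of_forall_Ioo fun t ht j =>
    (hasDerivWithinAt_dev_mean_add hJ hsum hde hcov m (Ioo_subset_Icc_self ht) j).hasDerivAt
      (Icc_mem_nhds ht.1 ht.2)

end Existence

end SEKI

theorem theorem3p1 {d K J : ℕ}
    (A : Matrix (Fin K) (Fin d) ℝ)
    (Γ : Matrix (Fin K) (Fin K) ℝ) (hΓ : Γ.PosDef)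
    (C₀ : Matrix (Fin d) (Fin d) ℝ) (hC₀ : C₀.PosDef)
    (y : EuclideanSpace ℝ (Fin K))
    (R : EuclideanSpace ℝ (Fin d) → EReal) (hR : SEKI.IsRegularizer R)
    (x₀ : Fin J → EuclideanSpace ℝ (Fin d)) (hx₀ : (SEKI.cov x₀).PosDef)
    (hdom : R (SEKI.mean x₀) < ⊤)
    (T : ℝ) (hT : 0 < T) :
    ∃ x : ℝ → Fin J → EuclideanSpace ℝ (Fin d),
      -- existence (in particular, absolute continuity on `[0,T]`)
      SEKI.IsSolution A Γ C₀ y R T x₀ x ∧ ContinuousOn x (Icc 0 T) ∧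
      -- uniqueness
      (∀ z, SEKI.IsSolution A Γ C₀ y R T x₀ z → EqOn z x (Icc 0 T)) ∧
      -- the solution is the uniform limit of the unique Yosida-regularized solutions
      (∃ xτ : ℝ → ℝ → Fin J → EuclideanSpace ℝ (Fin d),
        (∀ τ > 0, SEKI.IsYosidaSolution A Γ C₀ y R τ T x₀ (xτ τ) ∧
          ∀ z, SEKI.IsYosidaSolution A Γ C₀ y R τ T x₀ z → EqOn z (xτ τ) (Icc 0 T)) ∧
        TendstoUniformlyOn xτ x (𝓝[>] 0) (Icc 0 T)) ∧
      -- contraction in the weighted norm, against any solution with the same initial covariance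
      (∀ (z₀ : Fin J → EuclideanSpace ℝ (Fin d)) (z : ℝ → Fin J → EuclideanSpace ℝ (Fin d)),
        SEKI.cov z₀ = SEKI.cov x₀ → SEKI.IsSolution A Γ C₀ y R T z₀ z →
        ∀ t ∈ Icc (0 : ℝ) T,
          (SEKI.cov (x t)).PosDef ∧ SEKI.cov (z t) = SEKI.cov (x t) ∧
          SEKI.wnorm (SEKI.cov (x t)) (SEKI.mean (x t) - SEKI.mean (z t)) ≤
            SEKI.wnorm (SEKI.cov x₀) (SEKI.mean x₀ - SEKI.mean z₀)) := by
  open SEKI in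
  have hM := posDef_hessian A hΓ hC₀
  have hJ := ne_zero_or_eq_zero_of_posDef hx₀
  obtain ⟨q, h, hp⟩ := exists_isCoercivePair hx₀ hM
  obtain ⟨e, he0, hsum, hde, hcov⟩ := exists_centred_deviations hx₀ hM hT
  have hex := fun τ (hτ : τ > 0) => exists_isYosidaMean hR hτ hT.le
    (continuousOn_covFlow (T := T) hx₀ hM) (fun t ht => precision_covFlow hx₀ hM ht.1)
    (act (Aᵀ * Γ⁻¹) y) (mean x₀)
  choose! m hm0 hm using hex
  obtain ⟨x, hx0, hunif, hac, hincl⟩ := hp.exists_mean_limit hR hT hdom.ne hm hm0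
  have hsol := isSolution_mean_add (y := y) (R := R) hJ he0 hsum hde hcov hx₀ hM hT.le hx0 hac hincl
  have hred := hsol.isReduced hx₀ hΓ hC₀ rfl
  have hmono : ∀ x y ξ η, ξ ∈ subdiff R x → η ∈ subdiff R y → 0 ≤ ⟪ξ - η, x - y⟫_ℝ :=
    fun _ _ _ _ hξ hη => hR.inner_subdiff_nonneg hξ hη
  refine ⟨_, hsol, ?_, fun z hz => ?_, ⟨fun τ t j => m τ t + e t j, fun τ hτ => ?_, ?_⟩,
    fun z₀ z hz₀ hz t ht => ?_⟩
  · have := hsol.absCont.continuousOn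
    rwa [uIcc_of_le hT.le] at this
  · exact (hz.isReduced hx₀ hΓ hC₀ rfl).eqOn hx₀ hM hmono hred (hz.init.trans hsol.init.symm)
  · have hy := isYosidaSolution_mean_add hJ he0 hsum hde hcov (hm0 τ hτ) (hm τ hτ)
    refine ⟨hy, fun z hz => ?_⟩
    refine (hz.isReduced hx₀ hΓ hC₀ hR hτ hT.le rfl).eqOn hx₀ hM ?_
      (hy.isReduced hx₀ hΓ hC₀ hR hτ hT.le rfl) (hz.init.trans hy.init.symm)
    rintro u w _ _ rfl rfl
    exact hR.inner_yosida_nonneg hτ u w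
  · rw [Metric.tendstoUniformlyOn_iff] at hunif ⊢
    intro ε hε
    filter_upwards [hunif ε hε] with τ hτ t ht
    refine (dist_pi_lt_iff hε).2 fun j => ?_
    rw [dist_add_right]
    exact hτ t ht
  · have hredz := hz.isReduced hx₀ hΓ hC₀ hz₀
    have hQ := posDef_precisionMatrix hx₀ hM ht.1
    refine ⟨?_, ?_, ?_⟩
    · rw [hred.cov_eq ht]; exact hQ.inv
    · rw [hred.cov_eq ht, hredz.cov_eq ht]
    · have hc := hred.contraction hx₀ hM hmono hredz ht
      rw [hsol.init, hz.init, ← op_precisionMatrix] at hc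
      rw [wnorm_eq_of_mul_eq_one (hred.cov_mul t ht), wnorm_eq_of_mul_eq_one
        (Matrix.mul_nonsing_inv _ ((Matrix.isUnit_iff_isUnit_det _).1 hx₀.isUnit))]
      exact Real.sqrt_le_sqrt hc
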